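/- Let $\mathbb C^{+2}=\{(z_1,z_2)\in\mathbb C^2 : \operatorname{Im} z_1>0,\ \operatorname{Im} z_2>0\}$, and let $q\colon\mathbb C^{+2}\to\mathbb C$ be a Herglotz–Nevanlinna function in two variables, i.e. a holomorphic function with non-negative imaginary part. For $z\in\mathbb C^{+2}$ and $t\in\mathbb R^2$ put $$K(z,t)=-\frac{i}{2}\Big(\frac1{t_1-z_1}-\frac1{t_1+i}\Big)\Big(\frac1{t_2-z_2}-\frac1{t_2+i}\Big)-\frac{i}{(1+t_1^2)(1+t_2^2)},\qquad \mathcal P(z,t)=\frac{\operatorname{Im}z_1}{|t_1-z_1|^2}\,\frac{\operatorname{Im}z_2}{|t_2-z_2|^2}.$$ By representation data of $q$ we mean $a\in\mathbb R$, $b_1,b_2\ge 0$ and a positive Borel measure $\mu$ on $\mathbb R^2$ with $$\iint_{\mathbb R^2}\frac{d\mu(t)}{(1+t_1^2)(1+t_2^2)}<\infty,\qquad \iint_{\mathbb R^2}\operatorname{Re}\Big[\Big(\frac1{t_1-\overline{z_1}}-\frac1{t_1+i}\Big)\Big(\frac1{t_2-z_2}-\frac1{t_2-i}\Big)\Big]d\mu(t)=0\quad\text{for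 all }z\in\mathbb C^{+2},$$ such that $$q(z)=a+b_1z_1+b_2z_2+\frac1{\pi^2}\iint_{\mathbb R^2}K(z,t)\,d\mu(t)\qquad\text{for all }z\in\mathbb C^{+2}.$$ Then the following hold. (i) If $\operatorname{Im} q(\zeta)=0$ for some $\zeta\in\mathbb C^{+2}$, then $q(z)=q(\zeta)$ for all $z\in\mathbb C^{+2}$; that is, $q$ is a real constant. Moreover, $q$ has representation data, and any representation data $(a,b_1,b_2,\mu)$ of $q$ satisfy: (ii) For all $z\in\mathbb C^{+2}$ the function $\mathcal P(z,\cdot)$ is $\mu$-integrable and $$\operatorname{Im}q(z)=b_1\operatorname{Im}z_1+b_2\operatorname{Im}z_2+\frac1{\pi^2}\iint_{\mathbb R^2}\mathcal P(z,t)\,d\mu(t).$$ (iii) $a=\operatorname{Re}q(i,i)$. (iv) For all $\alpha,\beta$ with $\operatorname{Im}\alpha>0$ and $\operatorname{Im}\beta>0$, $q(z,\alpha)/z\to b_1$ and $q(\beta,z)/z\to b_2$ as $z\to\infty$ non-tangentially, that is, as $|z|\to\infty$ within $\{z:\operatorname{Im}z>0,\ \theta\le\arg z\le\pi-\theta\}$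 for each $\theta\in(0,\pi/2]$. In particular the limits do not depend on $\alpha$ and $\beta$. -/

import Mathlib

open Complex MeasureTheory Filter Topology

namespace HerglotzNevanlinna

/-- The poly-upper half-plane in `ℂ²`. -/
def polyUpperHalfPlane : Set (ℂ × ℂ) := {z | 0 < z.1.im ∧ 0 < z.2.im}

/-- Herglotz–Nevanlinna functions in two variables: functions that are holomorphic and have
non-negative imaginary part on the poly-upper half-plane (values elsewhere are irrelevant). -/
def IsHerglotzNevanlinna (q : ℂ × ℂ → ℂ) : Prop :=
  DifferentiableOn ℂ q polyUpperHalfPlane ∧ ∀ z ∈ polyUpperHalfPlane, 0 ≤ (q z).im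

/-- The kernel `K(z, t)` of the integral representation. -/
noncomputable def kernelK (z : ℂ × ℂ) (t : ℝ × ℝ) : ℂ :=
  -(I / 2) * (1 / ((t.1 : ℂ) - z.1) - 1 / ((t.1 : ℂ) + I))
      * (1 / ((t.2 : ℂ) - z.2) - 1 / ((t.2 : ℂ) + I))
    - I / ((1 + (t.1 : ℂ) ^ 2) * (1 + (t.2 : ℂ) ^ 2))

/-- The Poisson kernel `𝒫(z, t)` of the poly-upper half-plane. -/
noncomputable def polyPoissonKernel (z : ℂ × ℂ) (t : ℝ × ℝ) : ℝ :=
  z.1.im / ‖(t.1 : ℂ) - z.1‖ ^ 2 * (z.2.im / ‖(t.2 : ℂ) - z.2‖ ^ 2)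

/-- The integrand in the Nevanlinna condition. -/
noncomputable def nevanlinnaKernel (z : ℂ × ℂ) (t : ℝ × ℝ) : ℝ :=
  ((1 / ((t.1 : ℂ) - (starRingEnd ℂ) z.1) - 1 / ((t.1 : ℂ) + I))
    * (1 / ((t.2 : ℂ) - z.2) - 1 / ((t.2 : ℂ) - I))).re

/-- The growth condition on a positive Borel measure on `ℝ²`. -/
def GrowthCondition (μ : Measure (ℝ × ℝ)) : Prop :=
  ∫⁻ t, ENNReal.ofReal (1 / ((1 + t.1 ^ 2) * (1 + t.2 ^ 2))) ∂μ < ⊤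

/-- The Nevanlinna condition. (Under the growth condition the integrand is integrable.) -/
def NevanlinnaCondition (μ : Measure (ℝ × ℝ)) : Prop :=
  ∀ z ∈ polyUpperHalfPlane, ∫ t, nevanlinnaKernel z t ∂μ = 0

/-- `(a, b₁, b₂, μ)` are data of an integral representation of `q` on the poly-upper
half-plane. (Under the growth condition the kernel is integrable.) -/
structure IsRepresentation (q : ℂ × ℂ → ℂ) (a b₁ b₂ : ℝ) (μ : Measure (ℝ × ℝ)) : Prop where
  b₁_nonneg : 0 ≤ b₁
  b₂_nonneg : 0 ≤ b₂
  growth : GrowthCondition μ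
  nevanlinna : NevanlinnaCondition μ
  eq_integral : ∀ z ∈ polyUpperHalfPlane,
    q z = a + b₁ * z.1 + b₂ * z.2 + 1 / (Real.pi : ℂ) ^ 2 * ∫ t, kernelK z t ∂μ

/-- The Stolz domain of angle `θ` in the upper half-plane. -/
def stolzDomain (θ : ℝ) : Set ℂ := {z | 0 < z.im ∧ θ ≤ arg z ∧ arg z ≤ Real.pi - θ}

/-- `f(z) → l` as `z → ∞` non-tangentially: in every Stolz domain, `f(z) → l` as `|z| → ∞`. -/
def NontangentialLimitAtInfty (f : ℂ → ℂ) (l : ℂ) : Prop :=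
  ∀ θ : ℝ, 0 < θ → θ ≤ Real.pi / 2 →
    Tendsto f (comap norm atTop ⊓ 𝓟 (stolzDomain θ)) (𝓝 l)

end HerglotzNevanlinna

open scoped ComplexConjugate

namespace HerglotzNevanlinna

/-! Rigidity is the maximum principle: `(q - I) / (q + I)` has modulus at most `1`, and modulus `1`
exactly where `q` is real.

Write `C₁`, `C₂` for `cayleyKernel` at `(z₁, t₁)`, `(z₂, t₂)`, and `W = 1 / ((1 + t₁²)(1 + t₂²))`.
Then `K = i(2(1 + C₁)(1 + C₂) - 1)W`, the Nevanlinna kernel is `4 Re(conj C₁ · C₂)W`, and the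
Poisson kernel is `(1 + 2 Re C₁)(1 + 2 Re C₂)W`. Hence the Poisson kernel is `Im K` plus half the
Nevanlinna kernel, whose integral vanishes; this gives the formula for `Im q`. At `(i, i)` both `C₁`
and `C₂` vanish, so `K` is purely imaginary and `a` is read off. The limits at infinity follow by
dominated convergence in Stolz domains.

For existence, move `q` to the bidisk by the Cayley transform. If `G` is holomorphic on the closed
bidisk, the measure `Im G` times arc length represents it, by Cauchy's formula on the torus
(`integral_im_mul_bidiskKernel`), and is orthogonal to the mixed kernels `conj k₁ · k₂`
(`integral_im_mul_conj_mul`). Dilations and weak compactness extend both facts to the open bidisk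
(`exists_measure_of_bidisk`).

It remains to treat the part of the torus over infinity, where some `ζⱼ = 1`. Radial limits of the
orthogonality relation show that the corner is null and that each of the two circles contributes
only through its mass, giving `b₁ z₁` and `b₂ z₂`. The rest of the measure pulls back to `μ` on the
plane. -/

/-! ### Rigidity via the maximum principle. -/

lemma isOpen_polyUpperHalfPlane : IsOpen polyUpperHalfPlane :=
  (isOpen_lt continuous_const (continuous_im.comp continuous_fst)).inter
    (isOpen_lt continuous_const (continuous_im.comp continuous_snd))

lemma isPreconnected_polyUpperHalfPlane : IsPreconnected polyUpperHalfPlane := by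
  have h : polyUpperHalfPlane = {z : ℂ | 0 < z.im} ×ˢ {z : ℂ | 0 < z.im} := rfl
  rw [h]
  exact ((convex_halfSpace_im_gt 0).prod (convex_halfSpace_im_gt 0)).isPreconnected

/-- This is why the Cayley transform sends the upper half-plane into the disk and the real line to
the circle. -/
lemma sq_norm_add_I_sub_sq_norm_sub_I (x : ℂ) : ‖x + I‖ ^ 2 - ‖x - I‖ ^ 2 = 4 * x.im := by
  rw [← normSq_eq_norm_sq, ← normSq_eq_norm_sq, normSq_apply, normSq_apply]
  simp
  ring

lemma add_I_ne_zero {x : ℂ} (hx : 0 ≤ x.im) : x + I ≠ 0 := fun h => by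
  have := congrArg Complex.im h
  simp at this
  linarith

/-- A Herglotz–Nevanlinna function with a real value is constant. -/
theorem IsHerglotzNevanlinna.eq_of_im_eq_zero {q : ℂ × ℂ → ℂ} (hq : IsHerglotzNevanlinna q)
    {ζ : ℂ × ℂ} (hζ : ζ ∈ polyUpperHalfPlane) (h0 : (q ζ).im = 0)
    {z : ℂ × ℂ} (hz : z ∈ polyUpperHalfPlane) : q z = q ζ := by
  have hne : ∀ w ∈ polyUpperHalfPlane, q w + I ≠ 0 := fun w hw => add_I_ne_zero (hq.2 w hw)
  have hd : DifferentiableOn ℂ (fun w => (q w - I) / (q w + I)) polyUpperHalfPlane :=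
    ((hq.1.sub_const I).mul ((hq.1.add_const I).fun_inv hne)).congr
      fun w _ => div_eq_mul_inv _ _
  have hm : IsMaxOn (norm ∘ fun w => (q w - I) / (q w + I)) polyUpperHalfPlane ζ := by
    intro w hw
    have h1 := sq_norm_add_I_sub_sq_norm_sub_I (q w)
    have h2 := sq_norm_add_I_sub_sq_norm_sub_I (q ζ)
    have h3 := norm_pos_iff.2 (hne w hw)
    have h4 := norm_pos_iff.2 (hne ζ hζ)
    have h5 : ‖q ζ - I‖ = ‖q ζ + I‖ := by
      rw [← sq_eq_sq₀ (norm_nonneg _) (norm_nonneg _)]; linarith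
    have h6 : ‖q w - I‖ ≤ ‖q w + I‖ := by
      rw [← sq_le_sq₀ (norm_nonneg _) (norm_nonneg _)]; linarith [hq.2 w hw]
    simp only [Function.comp, Set.mem_ofPred_eq, norm_div, h5, div_self h4.ne']
    exact (div_le_one h3).2 h6
  have h := eqOn_of_isPreconnected_of_isMaxOn_norm isPreconnected_polyUpperHalfPlane
    isOpen_polyUpperHalfPlane hd hζ hm hz
  simp only [Function.const] at h
  rw [div_eq_div_iff (hne z hz) (hne ζ hζ)] at h
  -- The Cayley transform is injective, so constancy passes back to `q`.
  have h7 : 2 * I * (q z - q ζ) = 0 := by linear_combination h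
  simpa [sub_eq_zero] using h7

/-! ### Algebra of the kernels. -/

/-- The Schwarz-type kernel in terms of which all kernels below are expressed; up to the Cayley
transform it is `w / (ζ - w)`. -/
noncomputable def cayleyKernel (z : ℂ) (t : ℝ) : ℂ := (z - I) * (t + I) / (2 * I * (t - z))

lemma ofReal_sub_ne_zero {z : ℂ} (hz : z.im ≠ 0) (t : ℝ) : (t : ℂ) - z ≠ 0 := fun h => by
  have := congrArg Complex.im h
  simp at this
  exact hz this

lemma ofReal_add_I_ne_zero (t : ℝ) : (t : ℂ) + I ≠ 0 := add_I_ne_zero (by simp)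

lemma ofReal_sub_I_ne_zero (t : ℝ) : (t : ℂ) - I ≠ 0 := ofReal_sub_ne_zero (by simp) t

lemma one_add_sq_eq (t : ℝ) : 1 + (t : ℂ) ^ 2 = (t + I) * (t - I) := by
  linear_combination I_sq

lemma one_add_sq_ne_zero (t : ℝ) : 1 + (t : ℂ) ^ 2 ≠ 0 := by
  rw [one_add_sq_eq]
  exact mul_ne_zero (ofReal_add_I_ne_zero t) (ofReal_sub_I_ne_zero t)

lemma one_div_sub_one_div_add_I {z : ℂ} (hz : z.im ≠ 0) (t : ℝ) :
    1 / ((t : ℂ) - z) - 1 / (t + I) = 2 * I * (1 + cayleyKernel z t) / (1 + (t : ℂ) ^ 2) := by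
  have h1 := ofReal_sub_ne_zero hz t
  have h2 := ofReal_add_I_ne_zero t
  have h3 := ofReal_sub_I_ne_zero t
  rw [one_add_sq_eq, cayleyKernel]
  field_simp
  ring

lemma one_div_sub_one_div_sub_I {z : ℂ} (hz : z.im ≠ 0) (t : ℝ) :
    1 / ((t : ℂ) - z) - 1 / (t - I) = 2 * I * cayleyKernel z t / (1 + (t : ℂ) ^ 2) := by
  have h1 := ofReal_sub_ne_zero hz t
  have h2 := ofReal_add_I_ne_zero t
  have h3 := ofReal_sub_I_ne_zero t
  rw [one_add_sq_eq, cayleyKernel]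
  field_simp
  ring

lemma one_div_sub_conj_sub {z : ℂ} (hz : z.im ≠ 0) (t : ℝ) :
    1 / ((t : ℂ) - conj z) - 1 / (t + I)
      = -(2 * I * conj (cayleyKernel z t)) / (1 + (t : ℂ) ^ 2) := by
  have h := congrArg conj (one_div_sub_one_div_sub_I hz t)
  have h2 : conj (2 : ℂ) = 2 := conj_ofNat 2
  simpa [h2] using h

lemma im_div_sq_norm_eq {z : ℂ} (hz : z.im ≠ 0) (t : ℝ) :
    z.im / ‖(t : ℂ) - z‖ ^ 2 = (1 + 2 * (cayleyKernel z t).re) / (1 + t ^ 2) := by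
  have h1 := ofReal_sub_ne_zero hz t
  have h1' : (t : ℂ) - conj z ≠ 0 := ofReal_sub_ne_zero (by simpa using hz) t
  have h2 := ofReal_add_I_ne_zero t
  have h3 := ofReal_sub_I_ne_zero t
  apply ofReal_injective
  push_cast
  rw [one_add_sq_eq, ← ofReal_pow, ← normSq_eq_norm_sq, normSq_eq_conj_mul_self, im_eq_sub_conj,
    re_eq_add_conj, cayleyKernel]
  simp only [map_sub, map_mul, map_div₀, conj_ofReal, conj_I, map_add, map_ofNat]
  field_simp
  ring

lemma kernelK_eq {z : ℂ × ℂ} (hz : z ∈ polyUpperHalfPlane) (t : ℝ × ℝ) :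
    kernelK z t = I * (2 * (1 + cayleyKernel z.1 t.1) * (1 + cayleyKernel z.2 t.2) - 1)
      / ((1 + (t.1 : ℂ) ^ 2) * (1 + (t.2 : ℂ) ^ 2)) := by
  have h1 := one_add_sq_ne_zero t.1
  have h2 := one_add_sq_ne_zero t.2
  rw [kernelK, one_div_sub_one_div_add_I hz.1.ne', one_div_sub_one_div_add_I hz.2.ne']
  field_simp
  linear_combination (-2 * (1 + cayleyKernel z.1 t.1) * (1 + cayleyKernel z.2 t.2)) * I_sq

lemma nevanlinnaKernel_eq {z : ℂ × ℂ} (hz : z ∈ polyUpperHalfPlane) (t : ℝ × ℝ) :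
    nevanlinnaKernel z t = 4 * (conj (cayleyKernel z.1 t.1) * cayleyKernel z.2 t.2).re
      / ((1 + t.1 ^ 2) * (1 + t.2 ^ 2)) := by
  have h1 := one_add_sq_ne_zero t.1
  have h2 := one_add_sq_ne_zero t.2
  rw [nevanlinnaKernel, one_div_sub_conj_sub hz.1.ne', one_div_sub_one_div_sub_I hz.2.ne']
  have h : -(2 * I * conj (cayleyKernel z.1 t.1)) / (1 + (t.1 : ℂ) ^ 2)
      * (2 * I * cayleyKernel z.2 t.2 / (1 + (t.2 : ℂ) ^ 2))
      = ((4 / ((1 + t.1 ^ 2) * (1 + t.2 ^ 2)) : ℝ) : ℂ)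
        * (conj (cayleyKernel z.1 t.1) * cayleyKernel z.2 t.2) := by
    push_cast
    field_simp
    linear_combination (-4 * conj (cayleyKernel z.1 t.1) * cayleyKernel z.2 t.2) * I_sq
  rw [h, re_ofReal_mul]
  ring

/-- In terms of the Cayley kernels this is `2 Re(C₁ C₂) + 2 Re(conj C₁ · C₂) = 4 Re C₁ · Re C₂`. -/
lemma polyPoissonKernel_eq {z : ℂ × ℂ} (hz : z ∈ polyUpperHalfPlane) (t : ℝ × ℝ) :
    polyPoissonKernel z t = (kernelK z t).im + 1 / 2 * nevanlinnaKernel z t := by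
  rw [polyPoissonKernel, im_div_sq_norm_eq hz.1.ne', im_div_sq_norm_eq hz.2.ne',
    nevanlinnaKernel_eq hz, kernelK_eq hz]
  have h : I * (2 * (1 + cayleyKernel z.1 t.1) * (1 + cayleyKernel z.2 t.2) - 1)
      / ((1 + (t.1 : ℂ) ^ 2) * (1 + (t.2 : ℂ) ^ 2))
      = ((1 / ((1 + t.1 ^ 2) * (1 + t.2 ^ 2)) : ℝ) : ℂ)
        * (I * (2 * (1 + cayleyKernel z.1 t.1) * (1 + cayleyKernel z.2 t.2) - 1)) := by
    push_cast
    ring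
  rw [h, im_ofReal_mul]
  simp
  field_simp
  ring

/-! ### Integrability under the growth condition. -/

lemma exists_norm_sub_I_le {w : ℂ} (hw : w.im ≠ 0) :
    ∃ C > 0, ∀ t : ℝ, ‖(t : ℂ) - I‖ ≤ C * ‖(t : ℂ) - w‖ := by
  have hw' : 0 < |w.im| := abs_pos.2 hw
  refine ⟨1 + ‖w - I‖ / |w.im|, by positivity, fun t => ?_⟩
  have h1 : |w.im| ≤ ‖(t : ℂ) - w‖ := by
    simpa using abs_im_le_norm ((t : ℂ) - w)
  have h2 : ‖(t : ℂ) - I‖ ≤ ‖(t : ℂ) - w‖ + ‖w - I‖ := norm_sub_le_norm_sub_add_norm_sub _ _ _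
  have h3 : ‖w - I‖ ≤ ‖w - I‖ / |w.im| * ‖(t : ℂ) - w‖ := by
    rw [div_mul_eq_mul_div, le_div_iff₀ hw']
    gcongr
  linarith

lemma sq_norm_ofReal_sub_I (t : ℝ) : ‖(t : ℂ) - I‖ ^ 2 = 1 + t ^ 2 := by
  rw [← normSq_eq_norm_sq, normSq_apply]
  simp
  ring

lemma norm_ofReal_add_I (t : ℝ) : ‖(t : ℂ) + I‖ = ‖(t : ℂ) - I‖ := by
  rw [← norm_conj]
  simp [sub_eq_add_neg]

/-- The difference is `(w - v) / ((t - w)(t - v))`, and both factors below dominate `|t - i|` up to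
constants. -/
lemma exists_norm_one_div_sub_le {w v : ℂ} (hw : w.im ≠ 0) (hv : v.im ≠ 0) :
    ∃ C > 0, ∀ t : ℝ, ‖1 / ((t : ℂ) - w) - 1 / (t - v)‖ ≤ C / (1 + t ^ 2) := by
  obtain ⟨A, hA, hA'⟩ := exists_norm_sub_I_le hw
  obtain ⟨B, hB, hB'⟩ := exists_norm_sub_I_le hv
  refine ⟨(‖w - v‖ + 1) * (A * B), by positivity, fun t => ?_⟩
  have h1 := ofReal_sub_ne_zero hw t
  have h2 := ofReal_sub_ne_zero hv t
  have h3 : 1 / ((t : ℂ) - w) - 1 / (t - v) = (w - v) / ((t - w) * (t - v)) := by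
    field_simp
    ring
  have h4 := norm_pos_iff.2 h1
  have h5 := norm_pos_iff.2 h2
  rw [h3, norm_div, norm_mul, div_le_div_iff₀ (by positivity) (by positivity),
    ← sq_norm_ofReal_sub_I, sq]
  calc ‖w - v‖ * (‖(t : ℂ) - I‖ * ‖(t : ℂ) - I‖)
      ≤ (‖w - v‖ + 1) * ((A * ‖(t : ℂ) - w‖) * (B * ‖(t : ℂ) - v‖)) := by
        gcongr
        · linarith
        · exact hA' t
        · exact hB' t
    _ = _ := by ring

lemma GrowthCondition.integrable {μ : Measure (ℝ × ℝ)} (hμ : GrowthCondition μ) :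
    Integrable (fun t : ℝ × ℝ => 1 / ((1 + t.1 ^ 2) * (1 + t.2 ^ 2))) μ := by
  refine ⟨Measurable.aestronglyMeasurable (by fun_prop), ?_⟩
  rw [hasFiniteIntegral_iff_ofReal (Eventually.of_forall fun t => by positivity)]
  exact hμ

lemma measurable_kernelK (z : ℂ × ℂ) : Measurable (kernelK z) := by
  unfold kernelK
  fun_prop

lemma measurable_nevanlinnaKernel (z : ℂ × ℂ) : Measurable (nevanlinnaKernel z) := by
  unfold nevanlinnaKernel
  fun_prop

lemma norm_kernelK_le (z : ℂ × ℂ) (t : ℝ × ℝ) :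
    ‖kernelK z t‖ ≤ ‖1 / ((t.1 : ℂ) - z.1) - 1 / (t.1 + I)‖
      * ‖1 / ((t.2 : ℂ) - z.2) - 1 / (t.2 + I)‖ + 1 / ((1 + t.1 ^ 2) * (1 + t.2 ^ 2)) := by
  rw [kernelK]
  refine (norm_sub_le _ _).trans ?_
  have h (x : ℝ) : ‖1 + (x : ℂ) ^ 2‖ = 1 + x ^ 2 := by
    rw [← ofReal_pow, ← ofReal_one, ← ofReal_add, norm_real, Real.norm_of_nonneg (by positivity)]
  have h0 := norm_nonneg (1 / ((t.1 : ℂ) - z.1) - 1 / (t.1 + I))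
  have h1 := norm_nonneg (1 / ((t.2 : ℂ) - z.2) - 1 / (t.2 + I))
  gcongr ?_ + ?_
  · rw [norm_mul, norm_mul]
    gcongr
    have : ‖-(I / 2)‖ = 1 / 2 := by simp
    rw [this]
    linarith
  · rw [norm_div, norm_mul, h, h, norm_I]

lemma integrable_kernelK {μ : Measure (ℝ × ℝ)} (hμ : GrowthCondition μ) {z : ℂ × ℂ}
    (hz : z ∈ polyUpperHalfPlane) : Integrable (kernelK z) μ := by
  obtain ⟨A, hA, hA'⟩ := exists_norm_one_div_sub_le (v := -I) hz.1.ne' (by simp)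
  obtain ⟨B, hB, hB'⟩ := exists_norm_one_div_sub_le (v := -I) hz.2.ne' (by simp)
  simp only [sub_neg_eq_add] at hA' hB'
  refine (hμ.integrable.const_mul (A * B + 1)).mono' (measurable_kernelK z).aestronglyMeasurable
    (Eventually.of_forall fun t => (norm_kernelK_le z t).trans ?_)
  calc _ ≤ A / (1 + t.1 ^ 2) * (B / (1 + t.2 ^ 2)) + 1 / ((1 + t.1 ^ 2) * (1 + t.2 ^ 2)) := by
        gcongr
        · exact hA' _
        · exact hB' _
    _ = _ := by field_simp

lemma integrable_nevanlinnaKernel {μ : Measure (ℝ × ℝ)} (hμ : GrowthCondition μ) {z : ℂ × ℂ}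
    (hz : z ∈ polyUpperHalfPlane) : Integrable (nevanlinnaKernel z) μ := by
  obtain ⟨A, hA, hA'⟩ := exists_norm_one_div_sub_le (w := conj z.1) (v := -I)
    (by simpa using hz.1.ne') (by simp)
  obtain ⟨B, hB, hB'⟩ := exists_norm_one_div_sub_le (v := I) hz.2.ne' (by simp)
  simp only [sub_neg_eq_add] at hA'
  refine (hμ.integrable.const_mul (A * B)).mono'
    (measurable_nevanlinnaKernel z).aestronglyMeasurable
    (Eventually.of_forall fun t => (abs_re_le_norm _).trans ?_)
  rw [norm_mul]
  calc _ ≤ A / (1 + t.1 ^ 2) * (B / (1 + t.2 ^ 2)) := by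
        gcongr
        · exact hA' _
        · exact hB' _
    _ = _ := by field_simp

lemma integrable_polyPoissonKernel {μ : Measure (ℝ × ℝ)} (hμ : GrowthCondition μ) {z : ℂ × ℂ}
    (hz : z ∈ polyUpperHalfPlane) : Integrable (polyPoissonKernel z) μ := by
  rw [funext (polyPoissonKernel_eq hz)]
  exact (integrable_kernelK hμ hz).im.add ((integrable_nevanlinnaKernel hμ hz).const_mul _)

/-! ### The imaginary part of `q` and the constant `a`. -/

theorem IsRepresentation.im_eq {q : ℂ × ℂ → ℂ} {a b₁ b₂ : ℝ} {μ : Measure (ℝ × ℝ)}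
    (h : IsRepresentation q a b₁ b₂ μ) {z : ℂ × ℂ} (hz : z ∈ polyUpperHalfPlane) :
    (q z).im = b₁ * z.1.im + b₂ * z.2.im
      + 1 / Real.pi ^ 2 * ∫ t, polyPoissonKernel z t ∂μ := by
  have hK := integrable_kernelK h.growth hz
  have hi : ∫ t, polyPoissonKernel z t ∂μ = (∫ t, kernelK z t ∂μ).im := by
    have hK' : Integrable (fun t => (kernelK z t).im) μ := hK.im
    rw [integral_congr_ae (Eventually.of_forall (polyPoissonKernel_eq hz)),
      integral_add hK' ((integrable_nevanlinnaKernel h.growth hz).const_mul _),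
      integral_const_mul, h.nevanlinna z hz, mul_zero, add_zero]
    exact integral_im hK
  have hc : 1 / (Real.pi : ℂ) ^ 2 = ((1 / Real.pi ^ 2 : ℝ) : ℂ) := by push_cast; rfl
  rw [hi, h.eq_integral z hz, hc]
  simp only [add_im, im_ofReal_mul, ofReal_im, zero_add]

theorem IsRepresentation.eq_re {q : ℂ × ℂ → ℂ} {a b₁ b₂ : ℝ} {μ : Measure (ℝ × ℝ)}
    (h : IsRepresentation q a b₁ b₂ μ) : a = (q (I, I)).re := by
  have hz : (I, I) ∈ polyUpperHalfPlane := by simp [polyUpperHalfPlane]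
  have hK := integrable_kernelK h.growth hz
  have hi : (∫ t, kernelK (I, I) t ∂μ).re = 0 := by
    have h1 : ∫ t, (kernelK (I, I) t).re ∂μ = (∫ t, kernelK (I, I) t ∂μ).re := integral_re hK
    rw [← h1]
    refine integral_eq_zero_of_ae (Eventually.of_forall fun t => ?_)
    have h2 : kernelK (I, I) t = ((1 / ((1 + t.1 ^ 2) * (1 + t.2 ^ 2)) : ℝ) : ℂ) * I := by
      rw [kernelK_eq hz]
      simp only [cayleyKernel]
      push_cast
      ring
    simp only [h2, re_ofReal_mul, I_re, mul_zero, Pi.zero_apply]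
  have hc : 1 / (Real.pi : ℂ) ^ 2 = ((1 / Real.pi ^ 2 : ℝ) : ℂ) := by push_cast; rfl
  rw [h.eq_integral _ hz, hc]
  simp only [add_re, re_ofReal_mul, ofReal_re, I_re, hi, mul_zero, add_zero]

/-! ### Non-tangential limits. -/

lemma mul_norm_le_im_of_mem_stolzDomain {θ : ℝ} (h0 : 0 < θ) {z : ℂ} (hz : z ∈ stolzDomain θ) :
    Real.sin θ * ‖z‖ ≤ z.im := by
  have h1 : Real.sin θ ≤ Real.sin (arg z) := by
    rcases le_total (arg z) (Real.pi / 2) with h | h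
    · exact Real.sin_le_sin_of_le_of_le_pi_div_two (by linarith [Real.pi_pos]) h hz.2.1
    · rw [← Real.sin_pi_sub (arg z)]
      exact Real.sin_le_sin_of_le_of_le_pi_div_two (by linarith [Real.pi_pos]) (by linarith)
        (by linarith [hz.2.2])
  calc Real.sin θ * ‖z‖ ≤ Real.sin (arg z) * ‖z‖ := by gcongr
    _ = z.im := by rw [mul_comm, norm_mul_sin_arg]

lemma norm_ofReal_sub_ge_of_mem_stolzDomain {θ : ℝ} (h0 : 0 < θ) {z : ℂ}
    (hz : z ∈ stolzDomain θ) (t : ℝ) :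
    Real.sin θ * ‖z‖ ≤ ‖(t : ℂ) - z‖ ∧ Real.sin θ / 2 * |t| ≤ ‖(t : ℂ) - z‖ := by
  have h1 : Real.sin θ * ‖z‖ ≤ ‖(t : ℂ) - z‖ := by
    refine (mul_norm_le_im_of_mem_stolzDomain h0 hz).trans ((le_abs_self _).trans ?_)
    simpa using abs_im_le_norm ((t : ℂ) - z)
  refine ⟨h1, ?_⟩
  have h2 : |t| - ‖z‖ ≤ ‖(t : ℂ) - z‖ := by
    simpa using norm_sub_norm_le (t : ℂ) z
  have h3 : Real.sin θ ≤ 1 := Real.sin_le_one θ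
  have h4 : 0 ≤ Real.sin θ := by
    have h5 := hz.2.1
    have h6 := arg_le_pi z
    exact Real.sin_nonneg_of_nonneg_of_le_pi h0.le (by linarith)
  have h7 : Real.sin θ / 2 * (|t| - ‖z‖) ≤ 1 / 2 * ‖(t : ℂ) - z‖ := by
    refine (mul_le_mul_of_nonneg_left h2 (by positivity)).trans ?_
    gcongr
  linarith

/-- The first bound, uniform in `z`, is the dominating function; the second gives the pointwise
limit `0`. -/
lemma norm_one_div_sub_div_le_of_mem_stolzDomain {θ : ℝ} (h0 : 0 < θ) (h1 : θ ≤ Real.pi / 2)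
    {z : ℂ} (hz : z ∈ stolzDomain θ) (hz1 : 1 ≤ ‖z‖) (t : ℝ) :
    ‖(1 / ((t : ℂ) - z) - 1 / (t + I)) / z‖ ≤ 8 / Real.sin θ / (1 + t ^ 2) ∧
    ‖(1 / ((t : ℂ) - z) - 1 / (t + I)) / z‖ ≤ 2 / Real.sin θ / ‖z‖ := by
  have hs : 0 < Real.sin θ := Real.sin_pos_of_pos_of_lt_pi h0 (by linarith [Real.pi_pos])
  obtain ⟨hA, hB⟩ := norm_ofReal_sub_ge_of_mem_stolzDomain h0 hz t
  have hne := ofReal_sub_ne_zero hz.1.ne' t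
  have hI := ofReal_add_I_ne_zero t
  have hz0 : z ≠ 0 := by rintro rfl; simp at hz1; linarith
  have h3 : (1 / ((t : ℂ) - z) - 1 / (t + I)) / z = (z + I) / (z * ((t - z) * (t + I))) := by
    field_simp
    ring
  have h4 : ‖z + I‖ ≤ 2 * ‖z‖ := (norm_add_le _ _).trans (by rw [norm_I]; linarith)
  have h5 : 0 < ‖(t : ℂ) - z‖ := norm_pos_iff.2 hne
  have h6 : ‖(t : ℂ) + I‖ ^ 2 = 1 + t ^ 2 := by rw [norm_ofReal_add_I, sq_norm_ofReal_sub_I]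
  have h7 : 0 < ‖(t : ℂ) + I‖ := norm_pos_iff.2 hI
  have h8 : ‖(1 / ((t : ℂ) - z) - 1 / (t + I)) / z‖ ≤ 2 / (‖(t : ℂ) - z‖ * ‖(t : ℂ) + I‖) := by
    rw [h3, norm_div, norm_mul, norm_mul, div_le_div_iff₀ (by positivity) (by positivity)]
    calc _ ≤ 2 * ‖z‖ * (‖(t : ℂ) - z‖ * ‖(t : ℂ) + I‖) := by gcongr
      _ = _ := by ring
  constructor
  · refine h8.trans ?_
    -- Split `|t + i| ≤ |t| + 1`: `hB` controls `|t|`, while `hA` with `|z| ≥ 1` controls `1`.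
    have h9 : Real.sin θ * ‖(t : ℂ) + I‖ ≤ 4 * ‖(t : ℂ) - z‖ := by
      have h10 : ‖(t : ℂ) + I‖ ≤ |t| + 1 := by simpa using norm_add_le (t : ℂ) I
      nlinarith
    rw [div_div, ← h6, div_le_div_iff₀ (by positivity) (by positivity)]
    nlinarith
  · refine h8.trans ?_
    have h9 : 1 ≤ ‖(t : ℂ) + I‖ := by
      rw [← one_le_sq_iff₀ (norm_nonneg _), h6]; nlinarith
    rw [div_div, div_le_div_iff₀ (by positivity) (by positivity)]
    nlinarith [mul_le_mul_of_nonneg_left h9 h5.le]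

lemma tendsto_integral_kernelK_div {μ : Measure (ℝ × ℝ)} (hμ : GrowthCondition μ) {α : ℂ}
    (hα : 0 < α.im) :
    NontangentialLimitAtInfty (fun z => (∫ t, kernelK (z, α) t ∂μ) / z) 0 := by
  intro θ h0 h1
  set l : Filter ℂ := comap norm atTop ⊓ 𝓟 (stolzDomain θ)
  have hl1 : Tendsto (fun z : ℂ => ‖z‖) l atTop := tendsto_comap.mono_left inf_le_left
  have hl2 : ∀ᶠ z in l, z ∈ stolzDomain θ := mem_inf_of_right (mem_principal_self _)
  have hl3 : ∀ᶠ z in l, 1 ≤ ‖z‖ := hl1.eventually_ge_atTop 1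
  obtain ⟨B, hB, hB'⟩ := exists_norm_one_div_sub_le (v := -I) hα.ne' (by simp)
  simp only [sub_neg_eq_add] at hB'
  have key : ∀ z : ℂ, ∀ t : ℝ × ℝ, ‖kernelK (z, α) t / z‖
      ≤ ‖(1 / ((t.1 : ℂ) - z) - 1 / (t.1 + I)) / z‖ * (B / (1 + t.2 ^ 2))
        + 1 / ((1 + t.1 ^ 2) * (1 + t.2 ^ 2)) / ‖z‖ := by
    intro z t
    rw [norm_div, norm_div, div_mul_eq_mul_div, ← add_div]
    gcongr
    refine (norm_kernelK_le _ _).trans ?_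
    gcongr
    exact hB' _
  have h := tendsto_integral_filter_of_dominated_convergence (μ := μ) (l := l)
    (F := fun z t => kernelK (z, α) t / z) (f := fun _ => 0)
    (fun t : ℝ × ℝ => (8 / Real.sin θ * B + 1) * (1 / ((1 + t.1 ^ 2) * (1 + t.2 ^ 2))))
    (Eventually.of_forall fun z =>
      ((measurable_kernelK (z, α)).div_const z).aestronglyMeasurable)
    (by
      filter_upwards [hl2, hl3] with z hz hz1
      refine Eventually.of_forall fun t => (key z t).trans ?_
      calc _ ≤ 8 / Real.sin θ / (1 + t.1 ^ 2) * (B / (1 + t.2 ^ 2))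
            + 1 / ((1 + t.1 ^ 2) * (1 + t.2 ^ 2)) := by
            refine add_le_add ?_ (div_le_self (by positivity) hz1)
            gcongr
            exact (norm_one_div_sub_div_le_of_mem_stolzDomain h0 h1 hz hz1 _).1
        _ = _ := by field_simp)
    (hμ.integrable.const_mul _)
    (Eventually.of_forall fun t => by
      have h2 : Tendsto (fun z : ℂ => 2 / Real.sin θ / ‖z‖ * (B / (1 + t.2 ^ 2))
          + 1 / ((1 + t.1 ^ 2) * (1 + t.2 ^ 2)) / ‖z‖) l (𝓝 (0 * (B / (1 + t.2 ^ 2)) + 0)) :=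
        ((tendsto_const_nhds.div_atTop hl1).mul_const _).add (tendsto_const_nhds.div_atTop hl1)
      rw [zero_mul, zero_add] at h2
      refine squeeze_zero_norm' ?_ h2
      filter_upwards [hl2, hl3] with z hz hz1
      refine (key z t).trans ?_
      gcongr
      exact (norm_one_div_sub_div_le_of_mem_stolzDomain h0 h1 hz hz1 _).2)
  simpa only [integral_div, integral_zero] using h

lemma NontangentialLimitAtInfty.affine_add {F : ℂ → ℂ}
    (hF : NontangentialLimitAtInfty (fun z => F z / z) 0) {f : ℂ → ℂ} {b c d : ℂ}
    (hf : ∀ z : ℂ, 0 < z.im → f z = c + b * z + d * F z) :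
    NontangentialLimitAtInfty (fun z => f z / z) b := by
  intro θ h0 h1
  have hl1 : Tendsto (fun z : ℂ => ‖z‖) (comap norm atTop ⊓ 𝓟 (stolzDomain θ)) atTop :=
    tendsto_comap.mono_left inf_le_left
  have hl2 : ∀ᶠ z in comap norm atTop ⊓ 𝓟 (stolzDomain θ), z ∈ stolzDomain θ :=
    mem_inf_of_right (mem_principal_self _)
  have h2 : Tendsto (fun z : ℂ => c / z) (comap norm atTop ⊓ 𝓟 (stolzDomain θ)) (𝓝 0) := by
    rw [tendsto_zero_iff_norm_tendsto_zero]
    simp only [norm_div]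
    exact tendsto_const_nhds.div_atTop hl1
  have h3 := (h2.add (tendsto_const_nhds (x := b))).add ((hF θ h0 h1).const_mul d)
  rw [zero_add, mul_zero, add_zero] at h3
  refine h3.congr' ?_
  filter_upwards [hl2] with z hz
  have hz0 : z ≠ 0 := by rintro rfl; simpa using hz.1
  rw [hf z hz.1]
  field_simp

/-- By this symmetry the limit in the second variable is the limit in the first for the swapped
measure. -/
lemma kernelK_swap (z : ℂ × ℂ) (t : ℝ × ℝ) : kernelK z.swap t.swap = kernelK z t := by
  simp only [kernelK, Prod.fst_swap, Prod.snd_swap]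
  ring

lemma GrowthCondition.map_swap {μ : Measure (ℝ × ℝ)} (hμ : GrowthCondition μ) :
    GrowthCondition (μ.map Prod.swap) := by
  rw [GrowthCondition, lintegral_map (by fun_prop) measurable_swap]
  refine lt_of_eq_of_lt (lintegral_congr fun t => ?_) hμ
  rw [Prod.fst_swap, Prod.snd_swap, mul_comm]

lemma integral_kernelK_map_swap (μ : Measure (ℝ × ℝ)) (z : ℂ × ℂ) :
    ∫ t, kernelK z.swap t ∂(μ.map Prod.swap) = ∫ t, kernelK z t ∂μ := by
  rw [integral_map measurable_swap.aemeasurable (measurable_kernelK _).aestronglyMeasurable]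
  simp only [kernelK_swap]

theorem IsRepresentation.nontangentialLimit_fst {q : ℂ × ℂ → ℂ} {a b₁ b₂ : ℝ}
    {μ : Measure (ℝ × ℝ)} (h : IsRepresentation q a b₁ b₂ μ) {α : ℂ} (hα : 0 < α.im) :
    NontangentialLimitAtInfty (fun z => q (z, α) / z) (b₁ : ℂ) :=
  (tendsto_integral_kernelK_div h.growth hα).affine_add (c := a + b₂ * α)
    (d := 1 / (Real.pi : ℂ) ^ 2) fun z hz => by
    rw [h.eq_integral (z, α) ⟨hz, hα⟩]
    ring

theorem IsRepresentation.nontangentialLimit_snd {q : ℂ × ℂ → ℂ} {a b₁ b₂ : ℝ}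
    {μ : Measure (ℝ × ℝ)} (h : IsRepresentation q a b₁ b₂ μ) {β : ℂ} (hβ : 0 < β.im) :
    NontangentialLimitAtInfty (fun z => q (β, z) / z) (b₂ : ℂ) :=
  (tendsto_integral_kernelK_div h.growth.map_swap hβ).affine_add (c := a + b₁ * β)
    (d := 1 / (Real.pi : ℂ) ^ 2) fun z hz => by
    rw [h.eq_integral (β, z) ⟨hβ, hz⟩, ← integral_kernelK_map_swap μ (β, z)]
    simp only [Prod.swap_prod_mk]

/-! ### Cauchy integrals on the unit circle. -/

/-- The unit circle as a compact metric space. -/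
abbrev UnitCircle : Type := Metric.sphere (0 : ℂ) 1

/-- The parametrization of the unit circle by the angle. -/
noncomputable def circleExp (θ : ℝ) : UnitCircle := ⟨exp (θ * I), by simp [norm_exp]⟩

lemma continuous_circleExp : Continuous circleExp := by
  unfold circleExp
  fun_prop

/-- The normalized arc length measure on the unit circle. -/
noncomputable def circleMeasure : Measure UnitCircle :=
  (ENNReal.ofReal (2 * Real.pi)⁻¹ • volume.restrict (Set.Ioc 0 (2 * Real.pi))).map circleExp

instance : IsFiniteMeasure circleMeasure := by
  unfold circleMeasure
  have : IsFiniteMeasure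
      (ENNReal.ofReal (2 * Real.pi)⁻¹ • volume.restrict (Set.Ioc (0 : ℝ) (2 * Real.pi))) :=
    Measure.smul_finite _ ENNReal.ofReal_ne_top
  exact Measure.isFiniteMeasure_map _ _

lemma integrable_of_continuous {X E : Type*} [TopologicalSpace X] [CompactSpace X]
    [MeasurableSpace X] [BorelSpace X] [NormedAddCommGroup E] {μ : Measure X}
    [IsFiniteMeasure μ] {f : X → E} (hf : Continuous f) : Integrable f μ :=
  hf.integrable_of_hasCompactSupport (HasCompactSupport.of_compactSpace f)

lemma integral_circleMeasure {h : UnitCircle → ℂ} {H : ℂ → ℂ} (hc : Continuous h)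
    (hH : ∀ ζ : UnitCircle, h ζ = H ζ) :
    ∫ ζ, h ζ ∂circleMeasure = Real.circleAverage H 0 1 := by
  rw [circleMeasure, integral_map continuous_circleExp.aemeasurable hc.aestronglyMeasurable,
    integral_smul_measure, Real.circleAverage_def,
    intervalIntegral.integral_of_le Real.two_pi_pos.le,
    ENNReal.toReal_ofReal (by positivity)]
  simp [hH, circleMap, circleExp]

/-- The kernel `w / (ζ - w)` on the unit circle. -/
noncomputable def circleKernel (w : ℂ) (ζ : UnitCircle) : ℂ := w * conj (ζ : ℂ) / (1 - w * conj (ζ : ℂ))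

lemma one_sub_mul_conj_ne_zero {w : ℂ} (hw : ‖w‖ < 1) (ζ : UnitCircle) : 1 - w * conj (ζ : ℂ) ≠ 0 := by
  intro h
  have h1 : ‖w * conj (ζ : ℂ)‖ = ‖w‖ := by simp
  rw [← sub_eq_zero.1 h, norm_one] at h1
  linarith

lemma continuous_circleKernel {w : ℂ} (hw : ‖w‖ < 1) : Continuous (circleKernel w) := by
  unfold circleKernel
  exact Continuous.div (by fun_prop) (by fun_prop) (one_sub_mul_conj_ne_zero hw)

lemma one_add_circleKernel {w : ℂ} (hw : ‖w‖ < 1) (ζ : UnitCircle) :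
    1 + circleKernel w ζ = ((ζ : ℂ) - 0) / (ζ - w) := by
  have h1 := one_sub_mul_conj_ne_zero hw ζ
  have h2 : (ζ : ℂ) * conj (ζ : ℂ) = 1 := by rw [mul_conj']; simp
  have h3 : (ζ : ℂ) - w ≠ 0 := by
    intro h
    rw [← sub_eq_zero.1 h, h2] at h1
    simp at h1
  rw [circleKernel, eq_div_iff h3]
  field_simp
  linear_combination w * h2

/-- On the circle the conjugate kernel agrees with a function holomorphic on the closed disk and
equal to `1` at `0`, so integrating against it is a mean value at `0`. -/
lemma one_add_conj_circleKernel {w : ℂ} (ζ : UnitCircle) (hw : ‖w‖ < 1) :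
    1 + conj (circleKernel w ζ) = 1 / (1 - conj w * ζ) := by
  have h1 := one_sub_mul_conj_ne_zero hw ζ
  have h2 : 1 - conj w * (ζ : ℂ) ≠ 0 := by
    have := (map_ne_zero (starRingEnd ℂ)).2 h1
    simpa using this
  simp only [circleKernel, map_div₀, map_mul, map_sub, map_one, conj_conj]
  field_simp
  ring

section OneVariable

variable {H : ℂ → ℂ} (hH : DifferentiableOn ℂ H (Metric.closedBall 0 1))

include hH

lemma continuous_comp_coe_circle : Continuous fun ζ : UnitCircle => H ζ :=
  hH.continuousOn.comp_continuous continuous_subtype_val fun ζ => by simp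

lemma integral_mul_one_add_circleKernel {w : ℂ} (hw : ‖w‖ < 1) :
    ∫ ζ : UnitCircle, H ζ * (1 + circleKernel w ζ) ∂circleMeasure = H w := by
  have hd : DiffContOnCl ℂ H (Metric.ball 0 |1|) := by
    apply DifferentiableOn.diffContOnCl
    simpa [closure_ball] using hH
  rw [← hd.circleAverage_smul_div (w := w) (by simpa using hw)]
  refine integral_circleMeasure ((continuous_comp_coe_circle hH).mul
    (continuous_const.add (continuous_circleKernel hw))) fun ζ => ?_
  rw [one_add_circleKernel hw, smul_eq_mul, mul_comm]

lemma integral_mul_one_add_conj_circleKernel {w : ℂ} (hw : ‖w‖ < 1) :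
    ∫ ζ : UnitCircle, H ζ * (1 + conj (circleKernel w ζ)) ∂circleMeasure = H 0 := by
  have h0 : ∀ x ∈ Metric.closedBall (0 : ℂ) 1, 1 - conj w * x ≠ 0 := by
    intro x hx h
    have h1 : ‖conj w * x‖ < 1 := by
      rw [norm_mul, norm_conj]
      have : ‖x‖ ≤ 1 := by simpa using hx
      nlinarith [norm_nonneg w, norm_nonneg x]
    rw [← sub_eq_zero.1 h, norm_one] at h1
    exact lt_irrefl _ h1
  have hd : DiffContOnCl ℂ (fun x => H x / (1 - conj w * x)) (Metric.ball 0 |1|) := by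
    apply DifferentiableOn.diffContOnCl
    simp only [abs_one, closure_ball (0 : ℂ) one_ne_zero]
    exact hH.div (by fun_prop) h0
  have h2 := hd.circleAverage
  simp only [mul_zero, sub_zero, div_one] at h2
  rw [← h2]
  refine integral_circleMeasure ((continuous_comp_coe_circle hH).mul
    (continuous_const.add (continuous_conj.comp (continuous_circleKernel hw)))) fun ζ => ?_
  rw [one_add_conj_circleKernel ζ hw, mul_one_div]

lemma integral_coe_circle : ∫ ζ : UnitCircle, H ζ ∂circleMeasure = H 0 := by
  simpa [circleKernel] using integral_mul_one_add_circleKernel hH (w := 0) (by simp)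

lemma integral_mul_circleKernel {w : ℂ} (hw : ‖w‖ < 1) :
    ∫ ζ : UnitCircle, H ζ * circleKernel w ζ ∂circleMeasure = H w - H 0 := by
  have hc := continuous_comp_coe_circle hH
  have hk := continuous_circleKernel hw
  rw [← integral_mul_one_add_circleKernel hH hw, ← integral_coe_circle hH, ← integral_sub
    (integrable_of_continuous (show Continuous fun ζ : UnitCircle =>
      H ζ * (1 + circleKernel w ζ) from hc.mul (by fun_prop)))
    (integrable_of_continuous hc)]
  congr with ζ
  ring

lemma integral_mul_conj_circleKernel {w : ℂ} (hw : ‖w‖ < 1) :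
    ∫ ζ : UnitCircle, H ζ * conj (circleKernel w ζ) ∂circleMeasure = 0 := by
  have hc := continuous_comp_coe_circle hH
  have hk := continuous_circleKernel hw
  have h := integral_sub (μ := circleMeasure)
    (integrable_of_continuous (show Continuous fun ζ : UnitCircle =>
      H ζ * (1 + conj (circleKernel w ζ)) from hc.mul (by fun_prop)))
    (integrable_of_continuous hc)
  rw [integral_mul_one_add_conj_circleKernel hH hw, integral_coe_circle hH, sub_self] at h
  refine Eq.trans ?_ h
  congr with ζ
  ring

end OneVariable

/-! ### Cauchy integrals on the torus. -/

section TwoVariables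

variable {G : ℂ × ℂ → ℂ}
  (hG : DifferentiableOn ℂ G (Metric.closedBall 0 1 ×ˢ Metric.closedBall 0 1))

include hG

lemma continuous_comp_coe_torus : Continuous fun ζ : UnitCircle × UnitCircle => G (ζ.1, ζ.2) :=
  hG.continuousOn.comp_continuous (by fun_prop) fun ζ => by simp

lemma differentiableOn_slice_fst {w : ℂ} (hw : ‖w‖ ≤ 1) :
    DifferentiableOn ℂ (fun x => G (x, w)) (Metric.closedBall 0 1) :=
  hG.comp (by fun_prop) fun x hx => ⟨hx, by simpa using hw⟩

lemma differentiableOn_slice_snd {w : ℂ} (hw : ‖w‖ ≤ 1) :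
    DifferentiableOn ℂ (fun x => G (w, x)) (Metric.closedBall 0 1) :=
  hG.comp (by fun_prop) fun x hx => ⟨by simpa using hw, hx⟩

lemma integral_torus_mul {k₁ k₂ : UnitCircle → ℂ} (h₁ : Continuous k₁) (h₂ : Continuous k₂) :
    ∫ ζ : UnitCircle × UnitCircle, G (ζ.1, ζ.2) * (k₁ ζ.1 * k₂ ζ.2) ∂circleMeasure.prod circleMeasure
      = ∫ ζ : UnitCircle, (∫ η : UnitCircle, G (ζ, η) * k₂ η ∂circleMeasure) * k₁ ζ ∂circleMeasure := by
  have hc := continuous_comp_coe_torus hG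
  rw [integral_prod _ (integrable_of_continuous (show Continuous fun ζ : UnitCircle × UnitCircle =>
    G (ζ.1, ζ.2) * (k₁ ζ.1 * k₂ ζ.2) from hc.mul (by fun_prop)))]
  congr with ζ
  rw [← integral_mul_const]
  congr with η
  ring

variable {w : ℂ × ℂ} (hw₁ : ‖w.1‖ < 1) (hw₂ : ‖w.2‖ < 1)

include hw₁ hw₂

lemma integral_torus_mul_one_add :
    ∫ ζ : UnitCircle × UnitCircle, G (ζ.1, ζ.2) * ((1 + circleKernel w.1 ζ.1) * (1 + circleKernel w.2 ζ.2))
      ∂circleMeasure.prod circleMeasure = G w := by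
  rw [integral_torus_mul hG (k₁ := fun ζ => 1 + circleKernel w.1 ζ)
    (k₂ := fun ζ => 1 + circleKernel w.2 ζ) (continuous_const.add (continuous_circleKernel hw₁))
    (continuous_const.add (continuous_circleKernel hw₂))]
  rw [← integral_mul_one_add_circleKernel (differentiableOn_slice_fst hG hw₂.le) hw₁]
  congr with ζ
  rw [integral_mul_one_add_circleKernel (differentiableOn_slice_snd hG (by simp)) hw₂]

lemma integral_torus_mul_one_add_conj :
    ∫ ζ : UnitCircle × UnitCircle,
      G (ζ.1, ζ.2) * ((1 + conj (circleKernel w.1 ζ.1)) * (1 + conj (circleKernel w.2 ζ.2)))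
      ∂circleMeasure.prod circleMeasure = G (0, 0) := by
  rw [integral_torus_mul hG (k₁ := fun ζ => 1 + conj (circleKernel w.1 ζ))
    (k₂ := fun ζ => 1 + conj (circleKernel w.2 ζ))
    (continuous_const.add (continuous_conj.comp (continuous_circleKernel hw₁)))
    (continuous_const.add (continuous_conj.comp (continuous_circleKernel hw₂)))]
  rw [← integral_mul_one_add_conj_circleKernel
    (differentiableOn_slice_fst hG (w := 0) (by simp)) hw₁]
  congr with ζ
  rw [integral_mul_one_add_conj_circleKernel (differentiableOn_slice_snd hG (by simp)) hw₂]

/-- The inner integral is `G (ζ, w₂) - G (ζ, 0)`, still holomorphic in `ζ`, and the conjugate kernel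
annihilates such functions. -/
lemma integral_torus_mul_conj_mul :
    ∫ ζ : UnitCircle × UnitCircle, G (ζ.1, ζ.2) * (conj (circleKernel w.1 ζ.1) * circleKernel w.2 ζ.2)
      ∂circleMeasure.prod circleMeasure = 0 := by
  rw [integral_torus_mul hG (k₁ := fun ζ => conj (circleKernel w.1 ζ))
    (continuous_conj.comp (continuous_circleKernel hw₁)) (continuous_circleKernel hw₂)]
  refine Eq.trans ?_ (integral_mul_conj_circleKernel
    ((differentiableOn_slice_fst hG hw₂.le).fun_sub
      (differentiableOn_slice_fst hG (w := 0) (by simp))) hw₁)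
  congr with ζ
  rw [integral_mul_circleKernel (differentiableOn_slice_snd hG (by simp)) hw₂]

lemma integral_torus_mul_mul_conj :
    ∫ ζ : UnitCircle × UnitCircle, G (ζ.1, ζ.2) * (circleKernel w.1 ζ.1 * conj (circleKernel w.2 ζ.2))
      ∂circleMeasure.prod circleMeasure = 0 := by
  rw [integral_torus_mul hG (k₂ := fun ζ => conj (circleKernel w.2 ζ))
    (continuous_circleKernel hw₁) (continuous_conj.comp (continuous_circleKernel hw₂))]
  refine integral_eq_zero_of_ae (Eventually.of_forall fun ζ => ?_)
  simp only [Pi.zero_apply]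
  rw [integral_mul_conj_circleKernel (differentiableOn_slice_snd hG (by simp)) hw₂, zero_mul]

end TwoVariables

/-- Writing `Im g = (g - conj g) / 2i` reduces integrals against `Im g` to integrals of `g` itself.
-/
lemma integral_im_mul {X : Type*} [TopologicalSpace X] [CompactSpace X] [MeasurableSpace X]
    [BorelSpace X] {μ : Measure X} [IsFiniteMeasure μ] {g k : X → ℂ} (hg : Continuous g)
    (hk : Continuous k) :
    ∫ x, ((g x).im : ℂ) * k x ∂μ
      = (∫ x, g x * k x ∂μ - conj (∫ x, g x * conj (k x) ∂μ)) / (2 * I) := by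
  rw [← integral_conj, ← integral_sub (integrable_of_continuous (by fun_prop))
    (integrable_of_continuous (by fun_prop)), ← integral_div]
  congr with x
  rw [im_eq_sub_conj, map_mul, conj_conj]
  ring

/-- The kernel of the Herglotz representation on the bidisk, without the factor `I`. -/
noncomputable def bidiskKernel (w : ℂ × ℂ) (ζ : UnitCircle × UnitCircle) : ℂ :=
  2 * ((1 + circleKernel w.1 ζ.1) * (1 + circleKernel w.2 ζ.2)) - 1

lemma continuous_bidiskKernel {w : ℂ × ℂ} (hw₁ : ‖w.1‖ < 1) (hw₂ : ‖w.2‖ < 1) :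
    Continuous (bidiskKernel w) := by
  have h1 := continuous_circleKernel hw₁
  have h2 := continuous_circleKernel hw₂
  unfold bidiskKernel
  fun_prop

lemma integral_im_mul_bidiskKernel {G : ℂ × ℂ → ℂ}
    (hG : DifferentiableOn ℂ G (Metric.closedBall 0 1 ×ˢ Metric.closedBall 0 1))
    {w : ℂ × ℂ} (hw₁ : ‖w.1‖ < 1) (hw₂ : ‖w.2‖ < 1) :
    G w = (G (0, 0)).re + I * ∫ ζ : UnitCircle × UnitCircle,
      ((G (ζ.1, ζ.2)).im : ℂ) * bidiskKernel w ζ ∂circleMeasure.prod circleMeasure := by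
  have hc := continuous_comp_coe_torus hG
  have key : ∀ v : ℂ × ℂ, ‖v.1‖ < 1 → ‖v.2‖ < 1 →
      ∫ ζ : UnitCircle × UnitCircle, ((G (ζ.1, ζ.2)).im : ℂ)
        * ((1 + circleKernel v.1 ζ.1) * (1 + circleKernel v.2 ζ.2))
        ∂circleMeasure.prod circleMeasure = (G v - conj (G (0, 0))) / (2 * I) := by
    intro v h1 h2
    have h3 := continuous_circleKernel h1
    have h4 := continuous_circleKernel h2
    rw [integral_im_mul hc (k := fun ζ => (1 + circleKernel v.1 ζ.1) * (1 + circleKernel v.2 ζ.2))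
      (by fun_prop), integral_torus_mul_one_add hG h1 h2]
    simp only [map_mul, map_add, map_one]
    rw [integral_torus_mul_one_add_conj hG h1 h2]
  -- At the origin the product kernel is `1`; this accounts for the `-1` in `bidiskKernel`.
  have h0 := key (0, 0) (by simp) (by simp)
  simp only [circleKernel, zero_mul, zero_div, add_zero, mul_one] at h0
  have h3 := continuous_circleKernel hw₁
  have h4 := continuous_circleKernel hw₂
  have hi : Continuous fun ζ : UnitCircle × UnitCircle => ((G (ζ.1, ζ.2)).im : ℂ) :=
    continuous_ofReal.comp (continuous_im.comp hc)
  have h5 : ∫ ζ : UnitCircle × UnitCircle,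
      ((G (ζ.1, ζ.2)).im : ℂ) * bidiskKernel w ζ ∂circleMeasure.prod circleMeasure
      = 2 * ((G w - conj (G (0, 0))) / (2 * I)) - (G (0, 0) - conj (G (0, 0))) / (2 * I) := by
    rw [← key w hw₁ hw₂, ← h0, ← integral_const_mul, ← integral_sub
      (integrable_of_continuous (show Continuous fun ζ : UnitCircle × UnitCircle =>
        2 * (((G (ζ.1, ζ.2)).im : ℂ) * ((1 + circleKernel w.1 ζ.1) * (1 + circleKernel w.2 ζ.2)))
        from continuous_const.mul (hi.mul (by fun_prop)))) (integrable_of_continuous hi)]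
    congr with ζ
    rw [bidiskKernel]
    ring
  rw [h5, re_eq_add_conj]
  field_simp
  ring

lemma integral_im_mul_conj_mul {G : ℂ × ℂ → ℂ}
    (hG : DifferentiableOn ℂ G (Metric.closedBall 0 1 ×ˢ Metric.closedBall 0 1))
    {w : ℂ × ℂ} (hw₁ : ‖w.1‖ < 1) (hw₂ : ‖w.2‖ < 1) :
    ∫ ζ : UnitCircle × UnitCircle, ((G (ζ.1, ζ.2)).im : ℂ)
      * (conj (circleKernel w.1 ζ.1) * circleKernel w.2 ζ.2)
      ∂circleMeasure.prod circleMeasure = 0 := by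
  have h3 := continuous_circleKernel hw₁
  have h4 := continuous_circleKernel hw₂
  rw [integral_im_mul (continuous_comp_coe_torus hG)
    (k := fun ζ => conj (circleKernel w.1 ζ.1) * circleKernel w.2 ζ.2) (by fun_prop),
    integral_torus_mul_conj_mul hG hw₁ hw₂]
  simp only [map_mul, conj_conj]
  rw [integral_torus_mul_mul_conj hG hw₁ hw₂]
  simp

/-! ### The Herglotz representation on the bidisk. -/

/-- The measure has density `Im G` on the torus. Its mass depends only on `G (0, 0)`, which is what
makes the dilated measures below lie in one compact set. -/
lemma exists_finiteMeasure_of_closedBidisk {G : ℂ × ℂ → ℂ}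
    (hG : DifferentiableOn ℂ G (Metric.closedBall 0 1 ×ˢ Metric.closedBall 0 1))
    (him : ∀ w ∈ Metric.closedBall (0 : ℂ) 1 ×ˢ Metric.closedBall (0 : ℂ) 1, 0 ≤ (G w).im) :
    ∃ ν : FiniteMeasure (UnitCircle × UnitCircle), ν.mass = (G (0, 0)).im.toNNReal ∧
      ∀ w : ℂ × ℂ, ‖w.1‖ < 1 → ‖w.2‖ < 1 →
        G w = (G (0, 0)).re + I * ∫ ζ, bidiskKernel w ζ ∂(ν : Measure (UnitCircle × UnitCircle)) ∧
        ∫ ζ, conj (circleKernel w.1 ζ.1) * circleKernel w.2 ζ.2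
          ∂(ν : Measure (UnitCircle × UnitCircle)) = 0 := by
  have hc := continuous_comp_coe_torus hG
  have hi : Continuous fun ζ : UnitCircle × UnitCircle => (G (ζ.1, ζ.2)).im :=
    continuous_im.comp hc
  set ν := (circleMeasure.prod circleMeasure).withDensity
    fun ζ : UnitCircle × UnitCircle => ENNReal.ofReal (G (ζ.1, ζ.2)).im
  have hν : IsFiniteMeasure ν :=
    isFiniteMeasure_withDensity_ofReal (integrable_of_continuous hi).2
  have hint : ∀ k : UnitCircle × UnitCircle → ℂ, ∫ ζ, k ζ ∂ν
      = ∫ ζ : UnitCircle × UnitCircle, ((G (ζ.1, ζ.2)).im : ℂ) * k ζ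
        ∂circleMeasure.prod circleMeasure := by
    intro k
    rw [integral_withDensity_eq_integral_toReal_smul hi.measurable.ennreal_ofReal
      (Eventually.of_forall fun _ => ENNReal.ofReal_lt_top)]
    congr with ζ
    rw [ENNReal.toReal_ofReal (him _ (by simp)), real_smul]
  have hrep : ∀ w : ℂ × ℂ, ‖w.1‖ < 1 → ‖w.2‖ < 1 →
      G w = (G (0, 0)).re + I * ∫ ζ, bidiskKernel w ζ ∂ν := fun w h1 h2 => by
    rw [hint]
    exact integral_im_mul_bidiskKernel hG h1 h2
  refine ⟨⟨ν, hν⟩, ?_, fun w h1 h2 => ⟨hrep w h1 h2, ?_⟩⟩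
  · have h0 := congrArg Complex.im (hrep (0, 0) (by simp) (by simp))
    have h1 : ∀ ζ, bidiskKernel (0, 0) ζ = 1 := fun ζ => by
      simp [bidiskKernel, circleKernel]; norm_num
    simp only [h1, integral_const, real_smul, mul_one, add_im, ofReal_im, zero_add, mul_im, I_re,
      zero_mul, I_im, one_mul, ofReal_re] at h0
    rw [h0]
    apply NNReal.eq
    rw [Real.coe_toNNReal _ measureReal_nonneg]
    rfl
  · simp only [FiniteMeasure.toMeasure_mk]
    rw [hint]
    exact integral_im_mul_conj_mul hG h1 h2

/-- The Herglotz representation of holomorphic functions with non-negative imaginary part on the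
bidisk. -/
theorem exists_measure_of_bidisk {f : ℂ × ℂ → ℂ}
    (hf : DifferentiableOn ℂ f (Metric.ball 0 1 ×ˢ Metric.ball 0 1))
    (him : ∀ w ∈ Metric.ball (0 : ℂ) 1 ×ˢ Metric.ball (0 : ℂ) 1, 0 ≤ (f w).im) :
    ∃ ν : Measure (UnitCircle × UnitCircle), IsFiniteMeasure ν ∧
      ∀ w : ℂ × ℂ, ‖w.1‖ < 1 → ‖w.2‖ < 1 →
        f w = (f (0, 0)).re + I * ∫ ζ, bidiskKernel w ζ ∂ν ∧
        ∫ ζ, conj (circleKernel w.1 ζ.1) * circleKernel w.2 ζ.2 ∂ν = 0 := by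
  -- Each dilate `w ↦ f (r n • w)` is holomorphic on the closed bidisk, with the same value at the
  -- origin.
  set r : ℕ → ℝ := fun n => (n : ℝ) / (n + 1)
  have hr0 : ∀ n, 0 ≤ r n := fun n => by positivity
  have hr1 : ∀ n, r n < 1 := fun n => by
    rw [div_lt_one (by positivity)]
    linarith
  have hr : Tendsto r atTop (𝓝 1) := tendsto_natCast_div_add_atTop 1
  have hmaps : ∀ n, Set.MapsTo (fun w : ℂ × ℂ => r n • w)
      (Metric.closedBall 0 1 ×ˢ Metric.closedBall 0 1) (Metric.ball 0 1 ×ˢ Metric.ball 0 1) := by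
    have key : ∀ n, ∀ x : ℂ, ‖x‖ ≤ 1 → ‖r n • x‖ < 1 := by
      intro n x hx
      rw [norm_smul, Real.norm_of_nonneg (hr0 n)]
      nlinarith [hr0 n, hr1 n, norm_nonneg x]
    intro n w hw
    simp only [Set.mem_prod, mem_closedBall_zero_iff] at hw
    simp only [Set.mem_prod, mem_ball_zero_iff, Prod.smul_fst, Prod.smul_snd]
    exact ⟨key n _ hw.1, key n _ hw.2⟩
  have hex := fun n => exists_finiteMeasure_of_closedBidisk (G := fun w => f (r n • w))
    (hf.comp (by fun_prop) (hmaps n)) (fun w hw => him _ (hmaps n hw))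
  simp only [Prod.smul_mk, smul_zero] at hex
  choose ν hmass hν using hex
  -- An ultrafilter limit in the weak topology replaces the extraction of a subsequence.
  obtain ⟨ν₀, -, hlim⟩ := (isCompact_setOfPred_finiteMeasure_eq_of_compactSpace
    (UnitCircle × UnitCircle) (f (0, 0)).im.toNNReal).ultrafilter_le_nhds
    ((hyperfilter ℕ).map ν) (by
      rw [le_principal_iff]
      exact mem_map.2 (Eventually.of_forall hmass))
  have hlim' : Tendsto ν (hyperfilter ℕ) (𝓝 ν₀) := hlim
  have hr' := hr.mono_left Nat.hyperfilter_le_atTop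
  rw [FiniteMeasure.tendsto_iff_forall_integral_rclike_tendsto ℂ] at hlim'
  have hconv : ∀ k : UnitCircle × UnitCircle → ℂ, Continuous k →
      Tendsto (fun n => ∫ ζ, k ζ ∂(ν n : Measure (UnitCircle × UnitCircle))) (hyperfilter ℕ)
        (𝓝 (∫ ζ, k ζ ∂(ν₀ : Measure (UnitCircle × UnitCircle)))) := fun k hk =>
    hlim' (BoundedContinuousFunction.mkOfCompact ⟨k, hk⟩)
  refine ⟨ν₀, inferInstance, fun w h1 h2 => ⟨?_, ?_⟩⟩
  · have hw : Metric.ball (0 : ℂ) 1 ×ˢ Metric.ball (0 : ℂ) 1 ∈ 𝓝 w :=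
      (Metric.isOpen_ball.prod Metric.isOpen_ball).mem_nhds (by simp [h1, h2])
    have h3 : Tendsto (fun n => r n • w) (hyperfilter ℕ) (𝓝 w) := by
      simpa using hr'.smul_const w
    have h4 := ((hf.continuousOn.continuousAt hw).tendsto).comp h3
    refine tendsto_nhds_unique h4 ?_
    refine (((hconv _ (continuous_bidiskKernel h1 h2)).const_mul I).const_add
      ((f (0, 0)).re : ℂ)).congr fun n => ?_
    exact (hν n w h1 h2).1.symm
  · have h3 := continuous_circleKernel h1
    have h4 := continuous_circleKernel h2
    refine tendsto_nhds_unique (hconv _ (show Continuous fun ζ : UnitCircle × UnitCircle =>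
      conj (circleKernel w.1 ζ.1) * circleKernel w.2 ζ.2 by fun_prop)) ?_
    exact tendsto_const_nhds.congr fun n => ((hν n w h1 h2).2).symm

/-! ### The part of the measure over infinity. -/

/-- The point `1` of the unit circle, the image of infinity under the Cayley transform. -/
def circleOne : UnitCircle := ⟨1, by simp⟩

/-- At `ζ = 1` the product is exactly `r`; at any other `ζ` the kernel has a finite limit and the
factor `1 - r` kills it. -/
lemma tendsto_mul_circleKernel (ζ : UnitCircle) :
    Tendsto (fun r : ℝ => ((1 - r : ℝ) : ℂ) * circleKernel r ζ) (𝓝[<] 1)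
      (𝓝 (Set.indicator {circleOne} 1 ζ)) := by
  have hid : Tendsto (fun r : ℝ => (r : ℂ)) (𝓝[<] 1) (𝓝 1) :=
    (Complex.continuous_ofReal.tendsto' 1 1 (by simp)).mono_left nhdsWithin_le_nhds
  by_cases h : ζ = circleOne
  · subst h
    simp only [Set.mem_singleton_iff, Set.indicator_of_mem, Pi.one_apply]
    refine hid.congr' ?_
    filter_upwards [self_mem_nhdsWithin] with r hr
    have h1 : (1 - r : ℂ) ≠ 0 := by
      rw [← ofReal_one, ← ofReal_sub, ofReal_ne_zero, sub_ne_zero]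
      exact (ne_of_lt hr).symm
    simp only [circleKernel, circleOne, map_one, mul_one]
    push_cast
    field_simp
  · rw [Set.indicator_of_notMem (by simpa using h)]
    have h1 : (1 : ℂ) - 1 * conj (ζ : ℂ) ≠ 0 := by
      intro h2
      apply h
      have h3 : (ζ : ℂ) = 1 := by
        have := congrArg conj (sub_eq_zero.1 h2)
        simpa using this.symm
      exact Subtype.ext h3
    have h4 := (tendsto_const_nhds (x := (1 : ℂ)).sub hid).mul
      ((hid.mul_const (conj (ζ : ℂ))).div
        (tendsto_const_nhds.sub (hid.mul_const (conj (ζ : ℂ)))) h1)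
    rw [sub_self, zero_mul] at h4
    refine h4.congr fun r => ?_
    rw [circleKernel]
    push_cast
    rfl

lemma norm_mul_circleKernel_le {r : ℝ} (h0 : 0 ≤ r) (h1 : r < 1) (ζ : UnitCircle) :
    ‖((1 - r : ℝ) : ℂ) * circleKernel r ζ‖ ≤ 1 := by
  have h2 : ‖(r : ℂ) * conj (ζ : ℂ)‖ = r := by simp [abs_of_nonneg h0]
  have h3 : 1 - r ≤ ‖1 - (r : ℂ) * conj (ζ : ℂ)‖ := by
    have := norm_sub_norm_le (1 : ℂ) ((r : ℂ) * conj (ζ : ℂ))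
    rwa [h2, norm_one] at this
  rw [circleKernel, norm_mul, norm_div, h2, norm_real, Real.norm_of_nonneg (by linarith),
    ← mul_div_assoc, div_le_one (by linarith)]
  nlinarith

/-- Radial limits of the kernel isolate the part of a measure over the boundary point `1`. -/
lemma setIntegral_eq_zero_of_integral_circleKernel_mul {X : Type*} [MeasurableSpace X]
    {ν : Measure X} [IsFiniteMeasure ν] {p : X → UnitCircle} (hp : Measurable p) {g : X → ℂ}
    (hg : Integrable g ν)
    (h : ∀ w : ℂ, ‖w‖ < 1 → ∫ x, circleKernel w (p x) * g x ∂ν = 0) :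
    ∫ x in p ⁻¹' {circleOne}, g x ∂ν = 0 := by
  have hev : ∀ᶠ r : ℝ in 𝓝[<] 1, 0 ≤ r ∧ r < 1 := by
    filter_upwards [self_mem_nhdsWithin, Ioo_mem_nhdsLT (zero_lt_one' ℝ)] with r _ hr2
    exact ⟨hr2.1.le, hr2.2⟩
  have hlim := tendsto_integral_filter_of_dominated_convergence (μ := ν) (l := 𝓝[<] (1 : ℝ))
    (F := fun r x => ((1 - r : ℝ) : ℂ) * circleKernel r (p x) * g x)
    (f := fun x => Set.indicator {circleOne} 1 (p x) * g x) (fun x => ‖g x‖)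
    (by
      filter_upwards [hev] with r hr
      have h1 : Continuous (circleKernel (r : ℂ)) :=
        continuous_circleKernel (by simpa [abs_of_nonneg hr.1] using hr.2)
      exact ((h1.measurable.comp hp).const_mul _).aestronglyMeasurable.mul hg.1)
    (by
      filter_upwards [hev] with r hr
      refine Eventually.of_forall fun x => ?_
      rw [norm_mul]
      exact mul_le_of_le_one_left (norm_nonneg _) (norm_mul_circleKernel_le hr.1 hr.2 _))
    hg.norm
    (Eventually.of_forall fun x => (tendsto_mul_circleKernel (p x)).mul_const _)
  have h0 : (fun r : ℝ => ∫ x, ((1 - r : ℝ) : ℂ) * circleKernel r (p x) * g x ∂ν)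
      =ᶠ[𝓝[<] 1] fun _ => 0 := by
    filter_upwards [hev] with r hr
    simp only [mul_assoc]
    rw [integral_const_mul, h r (by simpa [abs_of_nonneg hr.1] using hr.2), mul_zero]
  have h1 := tendsto_nhds_unique (hlim.congr' h0) tendsto_const_nhds
  rw [← integral_indicator (hp (measurableSet_singleton _)), ← h1]
  congr with x
  by_cases hx : p x = circleOne
  · rw [Set.indicator_of_mem (by simpa using hx), Set.indicator_of_mem (by simpa using hx)]
    simp
  · rw [Set.indicator_of_notMem (by simpa using hx), Set.indicator_of_notMem (by simpa using hx)]
    simp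

section Boundary

variable {ν : Measure (UnitCircle × UnitCircle)} [IsFiniteMeasure ν]
  (h : ∀ w : ℂ × ℂ, ‖w.1‖ < 1 → ‖w.2‖ < 1 →
    ∫ ζ, conj (circleKernel w.1 ζ.1) * circleKernel w.2 ζ.2 ∂ν = 0)

include h

lemma setIntegral_circleKernel_snd {w : ℂ} (hw : ‖w‖ < 1) :
    ∫ ζ in Prod.fst ⁻¹' {circleOne}, circleKernel w ζ.2 ∂ν = 0 := by
  have hk := continuous_circleKernel hw
  have h1 := setIntegral_eq_zero_of_integral_circleKernel_mul (ν := ν) measurable_fst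
    (g := fun ζ => conj (circleKernel w ζ.2)) (integrable_of_continuous (by fun_prop))
    fun v hv => by
      have h2 := congrArg conj (h (v, w) hv hw)
      rw [← integral_conj] at h2
      simpa using h2
  rw [integral_conj] at h1
  simpa using h1

lemma setIntegral_circleKernel_fst {w : ℂ} (hw : ‖w‖ < 1) :
    ∫ ζ in Prod.snd ⁻¹' {circleOne}, conj (circleKernel w ζ.1) ∂ν = 0 := by
  have hk := continuous_circleKernel hw
  refine setIntegral_eq_zero_of_integral_circleKernel_mul (ν := ν) measurable_snd
    (g := fun ζ => conj (circleKernel w ζ.1)) (integrable_of_continuous (by fun_prop))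
    fun v hv => ?_
  simpa only [mul_comm] using h (w, v) hw hv

/-- A second radial limit, now in the other variable and for the measure restricted to `ζ₁ = 1`,
isolates the corner. -/
lemma measure_corner_eq_zero : ν (Prod.fst ⁻¹' {circleOne} ∩ Prod.snd ⁻¹' {circleOne}) = 0 := by
  have h1 := setIntegral_eq_zero_of_integral_circleKernel_mul
    (ν := ν.restrict (Prod.fst ⁻¹' {circleOne})) measurable_snd (g := fun _ => 1)
    (integrable_const 1) fun w hw => by simpa using setIntegral_circleKernel_snd h hw
  rw [setIntegral_const, real_smul, mul_one, ofReal_eq_zero, measureReal_eq_zero_iff,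
    Measure.restrict_apply (measurable_snd (measurableSet_singleton _)), Set.inter_comm] at h1
  exact h1

/-- Splitting off the boundary over infinity. -/
lemma integral_eq_add_boundary {k : UnitCircle × UnitCircle → ℂ} (hk : Continuous k) :
    ∫ ζ, k ζ ∂ν = ∫ ζ in {ζ | ζ.1 ≠ circleOne ∧ ζ.2 ≠ circleOne}, k ζ ∂ν
      + (∫ ζ in Prod.fst ⁻¹' {circleOne}, k ζ ∂ν + ∫ ζ in Prod.snd ⁻¹' {circleOne}, k ζ ∂ν) := by
  have hi : Integrable k ν := integrable_of_continuous hk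
  have hA : MeasurableSet (Prod.fst ⁻¹' {circleOne} : Set (UnitCircle × UnitCircle)) :=
    measurable_fst (measurableSet_singleton _)
  have hB : MeasurableSet (Prod.snd ⁻¹' {circleOne} : Set (UnitCircle × UnitCircle)) :=
    measurable_snd (measurableSet_singleton _)
  rw [← setIntegral_union₀ (measure_corner_eq_zero h) hB.nullMeasurableSet hi.integrableOn
    hi.integrableOn]
  have hC : ({ζ | ζ.1 ≠ circleOne ∧ ζ.2 ≠ circleOne} : Set (UnitCircle × UnitCircle))
      = (Prod.fst ⁻¹' {circleOne} ∪ Prod.snd ⁻¹' {circleOne})ᶜ := by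
    ext ζ
    simp
  rw [hC, add_comm, integral_add_compl (hA.union hB) hi]

/-- Where `ζ₁ = 1` the kernel is affine in `circleKernel w.2 ζ.2`, whose integral there vanishes;
only the constant term survives. -/
lemma setIntegral_bidiskKernel_fst {w : ℂ × ℂ} (hw₂ : ‖w.2‖ < 1) :
    ∫ ζ in Prod.fst ⁻¹' {circleOne}, bidiskKernel w ζ ∂ν
      = ν.real (Prod.fst ⁻¹' {circleOne}) * (1 + 2 * circleKernel w.1 circleOne) := by
  have hk := continuous_circleKernel hw₂
  have h1 : ∫ ζ in Prod.fst ⁻¹' {circleOne}, bidiskKernel w ζ ∂ν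
      = ∫ ζ in Prod.fst ⁻¹' {circleOne}, ((1 + 2 * circleKernel w.1 circleOne)
        + 2 * (1 + circleKernel w.1 circleOne) * circleKernel w.2 ζ.2) ∂ν := by
    refine setIntegral_congr_fun (measurable_fst (measurableSet_singleton _)) fun ζ hζ => ?_
    have h2 : ζ.1 = circleOne := hζ
    simp only [bidiskKernel, h2]
    ring
  rw [h1, integral_add (integrable_const _) (integrable_of_continuous (by fun_prop)),
    integral_const_mul, setIntegral_circleKernel_snd h hw₂, setIntegral_const, real_smul]
  ring

lemma setIntegral_bidiskKernel_snd {w : ℂ × ℂ} (hw₁ : ‖w.1‖ < 1) :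
    ∫ ζ in Prod.snd ⁻¹' {circleOne}, bidiskKernel w ζ ∂ν
      = ν.real (Prod.snd ⁻¹' {circleOne}) * (1 + 2 * circleKernel w.2 circleOne) := by
  have hk := continuous_circleKernel hw₁
  have h1 : ∫ ζ in Prod.snd ⁻¹' {circleOne}, bidiskKernel w ζ ∂ν
      = ∫ ζ in Prod.snd ⁻¹' {circleOne}, ((1 + 2 * circleKernel w.2 circleOne)
        + 2 * (1 + circleKernel w.2 circleOne) * circleKernel w.1 ζ.1) ∂ν := by
    refine setIntegral_congr_fun (measurable_snd (measurableSet_singleton _)) fun ζ hζ => ?_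
    have h2 : ζ.2 = circleOne := hζ
    simp only [bidiskKernel, h2]
    ring
  have h3 := congrArg conj (setIntegral_circleKernel_fst h hw₁)
  rw [← integral_conj] at h3
  simp only [conj_conj, map_zero] at h3
  rw [h1, integral_add (integrable_const _) (integrable_of_continuous (by fun_prop)),
    integral_const_mul, h3, setIntegral_const, real_smul]
  ring

/-- On each boundary circle one factor is constant and the other integrates to zero, so
orthogonality survives the removal of both circles. -/
lemma setIntegral_conj_circleKernel_mul {w : ℂ × ℂ} (hw₁ : ‖w.1‖ < 1) (hw₂ : ‖w.2‖ < 1) :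
    ∫ ζ in {ζ | ζ.1 ≠ circleOne ∧ ζ.2 ≠ circleOne},
      conj (circleKernel w.1 ζ.1) * circleKernel w.2 ζ.2 ∂ν = 0 := by
  have hk₁ := continuous_circleKernel hw₁
  have hk₂ := continuous_circleKernel hw₂
  have h1 := integral_eq_add_boundary h
    (k := fun ζ => conj (circleKernel w.1 ζ.1) * circleKernel w.2 ζ.2) (by fun_prop)
  have h2 : ∫ ζ in Prod.fst ⁻¹' {circleOne}, conj (circleKernel w.1 ζ.1) * circleKernel w.2 ζ.2 ∂ν
      = ∫ ζ in Prod.fst ⁻¹' {circleOne},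
        conj (circleKernel w.1 circleOne) * circleKernel w.2 ζ.2 ∂ν := by
    refine setIntegral_congr_fun (measurable_fst (measurableSet_singleton _)) fun ζ hζ => ?_
    have h3 : ζ.1 = circleOne := hζ
    simp only [h3]
  have h4 : ∫ ζ in Prod.snd ⁻¹' {circleOne}, conj (circleKernel w.1 ζ.1) * circleKernel w.2 ζ.2 ∂ν
      = ∫ ζ in Prod.snd ⁻¹' {circleOne},
        conj (circleKernel w.1 ζ.1) * circleKernel w.2 circleOne ∂ν := by
    refine setIntegral_congr_fun (measurable_snd (measurableSet_singleton _)) fun ζ hζ => ?_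
    have h3 : ζ.2 = circleOne := hζ
    simp only [h3]
  rw [h w hw₁ hw₂, h2, h4, integral_const_mul, integral_mul_const,
    setIntegral_circleKernel_snd h hw₂, setIntegral_circleKernel_fst h hw₁] at h1
  simpa using h1.symm

end Boundary

/-! ### Cayley transform and transfer of measures to the plane. -/

/-- The Cayley transform from the upper half-plane to the unit disk. -/
noncomputable def cayley (z : ℂ) : ℂ := (z - I) / (z + I)

/-- The inverse Cayley transform. -/
noncomputable def cayleyInv (w : ℂ) : ℂ := I * (1 + w) / (1 - w)

lemma norm_cayley_lt_one {z : ℂ} (hz : 0 < z.im) : ‖cayley z‖ < 1 := by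
  have h1 := sq_norm_add_I_sub_sq_norm_sub_I z
  have h2 := norm_pos_iff.2 (add_I_ne_zero hz.le)
  rw [cayley, norm_div, div_lt_one h2, ← sq_lt_sq₀ (norm_nonneg _) (norm_nonneg _)]
  linarith

lemma one_sub_ne_zero_of_norm_lt_one {w : ℂ} (hw : ‖w‖ < 1) : 1 - w ≠ 0 := by
  intro h
  rw [← sub_eq_zero.1 h, norm_one] at hw
  exact lt_irrefl _ hw

lemma cayleyInv_cayley {z : ℂ} (hz : 0 < z.im) : cayleyInv (cayley z) = z := by
  have h1 := add_I_ne_zero hz.le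
  have h2 := one_sub_ne_zero_of_norm_lt_one (norm_cayley_lt_one hz)
  rw [cayleyInv, div_eq_iff h2, cayley]
  field_simp
  ring

lemma im_cayleyInv_pos {w : ℂ} (hw : ‖w‖ < 1) : 0 < (cayleyInv w).im := by
  have h1 := one_sub_ne_zero_of_norm_lt_one hw
  have h2 : cayleyInv w = I * ((1 + w) * conj (1 - w)) / (normSq (1 - w) : ℂ) := by
    rw [normSq_eq_conj_mul_self, cayleyInv]
    have h3 := (map_ne_zero (starRingEnd ℂ)).2 h1
    field_simp
  have h4 : w.re ^ 2 + w.im ^ 2 < 1 := by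
    have h5 : ‖w‖ ^ 2 < 1 := by nlinarith [norm_nonneg w]
    rw [← normSq_eq_norm_sq, normSq_apply] at h5
    linarith
  rw [h2, div_ofReal_im]
  refine div_pos ?_ (normSq_pos.2 h1)
  simp
  nlinarith

/-- This turns the contributions of the circles over infinity into linear terms. -/
lemma I_mul_one_add_two_mul_circleKernel {z : ℂ} (hz : 0 < z.im) :
    I * (1 + 2 * circleKernel (cayley z) circleOne) = z := by
  have h2 := one_sub_ne_zero_of_norm_lt_one (norm_cayley_lt_one hz)
  conv_rhs => rw [← cayleyInv_cayley hz]
  simp only [circleKernel, circleOne, map_one, mul_one, cayleyInv]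
  field_simp
  ring

/-- The boundary values of the Cayley transform on the real line. -/
noncomputable def cayleyCircle (t : ℝ) : UnitCircle :=
  ⟨cayley t, by
    rw [mem_sphere_zero_iff_norm, cayley, norm_div, norm_ofReal_add_I]
    exact div_self (norm_ne_zero_iff.2 (ofReal_sub_I_ne_zero t))⟩

lemma continuous_cayleyCircle : Continuous cayleyCircle := by
  refine Continuous.subtype_mk ?_ _
  unfold cayley
  exact Continuous.div (by fun_prop) (by fun_prop) ofReal_add_I_ne_zero

lemma circleKernel_cayleyCircle {z : ℂ} (hz : 0 < z.im) (t : ℝ) :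
    circleKernel (cayley z) (cayleyCircle t) = cayleyKernel z t := by
  have h0 := one_sub_mul_conj_ne_zero (norm_cayley_lt_one hz) (cayleyCircle t)
  have h1 := add_I_ne_zero hz.le
  have h2 := ofReal_sub_I_ne_zero t
  have h3 := ofReal_sub_ne_zero hz.ne' t
  have h4 : conj ((cayleyCircle t : UnitCircle) : ℂ) = (t + I) / (t - I) := by
    simp [cayleyCircle, cayley, sub_eq_add_neg]
  rw [circleKernel, cayleyKernel, div_eq_div_iff h0 (by simp [h3]), h4, cayley]
  field_simp
  ring

lemma cayley_ofReal_ne_one (t : ℝ) : cayley t ≠ 1 := by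
  rw [cayley, Ne, div_eq_one_iff_eq (ofReal_add_I_ne_zero t)]
  intro h
  have h1 : (2 : ℂ) * I = 0 := by linear_combination -h
  simp at h1

lemma injective_cayleyCircle : Function.Injective cayleyCircle := by
  intro s t h
  have h1 : cayley s = cayley t := congrArg Subtype.val h
  rw [cayley, cayley, div_eq_div_iff (ofReal_add_I_ne_zero s) (ofReal_add_I_ne_zero t)] at h1
  have h2 : 2 * I * ((s : ℂ) - t) = 0 := by linear_combination h1
  simpa [sub_eq_zero] using h2

lemma range_cayleyCircle : Set.range cayleyCircle = {circleOne}ᶜ := by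
  ext ζ
  simp only [Set.mem_range, Set.mem_compl_iff, Set.mem_singleton_iff]
  constructor
  · rintro ⟨t, rfl⟩ h
    exact cayley_ofReal_ne_one t (congrArg Subtype.val h)
  · intro h
    have h1 : 1 - (ζ : ℂ) ≠ 0 := fun h2 => h (Subtype.ext (sub_eq_zero.1 h2).symm)
    have h2 : 1 - conj (ζ : ℂ) ≠ 0 := by
      have := (map_ne_zero (starRingEnd ℂ)).2 h1
      simpa using this
    have h3 : (ζ : ℂ) * conj (ζ : ℂ) = 1 := by rw [mul_conj']; simp
    have h4 : conj (cayleyInv ζ) = cayleyInv ζ := by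
      simp only [cayleyInv, map_div₀, map_mul, map_add, map_sub, map_one, conj_I]
      rw [div_eq_div_iff h2 h1]
      linear_combination (2 * I) * h3
    obtain ⟨t, ht⟩ := conj_eq_iff_real.1 h4
    refine ⟨t, Subtype.ext ?_⟩
    change cayley t = ζ
    rw [← ht, cayley, cayleyInv]
    have h5 : I * (1 + (ζ : ℂ)) / (1 - ζ) + I ≠ 0 := by
      rw [show I * (1 + (ζ : ℂ)) / (1 - ζ) + I = 2 * I / (1 - ζ) by field_simp; ring]
      simp [h1]
    rw [div_eq_iff h5]
    field_simp
    ring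

lemma measurableEmbedding_cayleyCircle :
    MeasurableEmbedding (Prod.map cayleyCircle cayleyCircle) :=
  (continuous_cayleyCircle.prodMap continuous_cayleyCircle).measurableEmbedding
    (injective_cayleyCircle.prodMap injective_cayleyCircle)

lemma range_prodMap_cayleyCircle : Set.range (Prod.map cayleyCircle cayleyCircle)
    = {ζ | ζ.1 ≠ circleOne ∧ ζ.2 ≠ circleOne} := by
  rw [Set.range_prodMap, range_cayleyCircle]
  rfl

/-- The measure on the plane corresponding to a measure on the torus. -/
noncomputable def planeMeasure (ν : Measure (UnitCircle × UnitCircle)) : Measure (ℝ × ℝ) :=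
  (ν.comap (Prod.map cayleyCircle cayleyCircle)).withDensity fun t =>
    ENNReal.ofReal (Real.pi ^ 2 * ((1 + t.1 ^ 2) * (1 + t.2 ^ 2)))

/-- The density of `planeMeasure` absorbs the denominators of the plane kernels; its `π²` offsets
the `1 / π²` of the representation. -/
lemma integral_planeMeasure (ν : Measure (UnitCircle × UnitCircle)) {g : ℝ × ℝ → ℂ}
    {k : UnitCircle × UnitCircle → ℂ}
    (hgk : ∀ t : ℝ × ℝ, g t * ((1 + (t.1 : ℂ) ^ 2) * (1 + (t.2 : ℂ) ^ 2))
      = k (cayleyCircle t.1, cayleyCircle t.2)) :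
    ∫ t, g t ∂planeMeasure ν = (Real.pi : ℂ) ^ 2
      * ∫ ζ in {ζ | ζ.1 ≠ circleOne ∧ ζ.2 ≠ circleOne}, k ζ ∂ν := by
  rw [planeMeasure, integral_withDensity_eq_integral_toReal_smul
    (Measurable.ennreal_ofReal (by fun_prop)) (Eventually.of_forall fun _ => ENNReal.ofReal_lt_top),
    ← range_prodMap_cayleyCircle, ← measurableEmbedding_cayleyCircle.map_comap,
    measurableEmbedding_cayleyCircle.integral_map, ← integral_const_mul]
  congr with t
  rw [ENNReal.toReal_ofReal (by positivity), real_smul, Prod.map_apply', ← hgk]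
  push_cast
  ring

lemma growthCondition_planeMeasure (ν : Measure (UnitCircle × UnitCircle)) [IsFiniteMeasure ν] :
    GrowthCondition (planeMeasure ν) := by
  rw [GrowthCondition, planeMeasure, lintegral_withDensity_eq_lintegral_mul _
    (Measurable.ennreal_ofReal (by fun_prop)) (Measurable.ennreal_ofReal (by fun_prop))]
  have h : ∀ t : ℝ × ℝ, ((fun t : ℝ × ℝ => ENNReal.ofReal (Real.pi ^ 2
      * ((1 + t.1 ^ 2) * (1 + t.2 ^ 2)))) * fun t : ℝ × ℝ =>
        ENNReal.ofReal (1 / ((1 + t.1 ^ 2) * (1 + t.2 ^ 2)))) t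
      = ENNReal.ofReal (Real.pi ^ 2) := by
    intro t
    rw [Pi.mul_apply, ← ENNReal.ofReal_mul (by positivity)]
    congr 1
    field_simp
  rw [lintegral_congr h, lintegral_const, measurableEmbedding_cayleyCircle.comap_apply]
  exact ENNReal.mul_lt_top ENNReal.ofReal_lt_top (measure_lt_top _ _)

/-! ### Existence of representation data. -/

theorem IsHerglotzNevanlinna.exists_isRepresentation {q : ℂ × ℂ → ℂ}
    (hq : IsHerglotzNevanlinna q) :
    ∃ (a b₁ b₂ : ℝ) (μ : Measure (ℝ × ℝ)), IsRepresentation q a b₁ b₂ μ := by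
  have hmaps : Set.MapsTo (fun w : ℂ × ℂ => (cayleyInv w.1, cayleyInv w.2))
      (Metric.ball 0 1 ×ˢ Metric.ball 0 1) polyUpperHalfPlane := fun w hw =>
    ⟨im_cayleyInv_pos (by simpa using hw.1), im_cayleyInv_pos (by simpa using hw.2)⟩
  have hd : DifferentiableOn ℂ cayleyInv (Metric.ball 0 1) := by
    unfold cayleyInv
    exact DifferentiableOn.div (by fun_prop) (by fun_prop)
      fun w hw => one_sub_ne_zero_of_norm_lt_one (by simpa using hw)
  have hdp : DifferentiableOn ℂ (fun w : ℂ × ℂ => (cayleyInv w.1, cayleyInv w.2))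
      (Metric.ball 0 1 ×ˢ Metric.ball 0 1) :=
    (hd.comp differentiableOn_fst fun w hw => hw.1).prodMk
      (hd.comp differentiableOn_snd fun w hw => hw.2)
  obtain ⟨ν, hν, h⟩ := exists_measure_of_bidisk (hq.1.comp hdp hmaps)
    (fun w hw => hq.2 _ (hmaps hw))
  have horth := fun w h1 h2 => (h w h1 h2).2
  have hbK : ∀ z ∈ polyUpperHalfPlane, ∀ t : ℝ × ℝ,
      kernelK z t * ((1 + (t.1 : ℂ) ^ 2) * (1 + (t.2 : ℂ) ^ 2))
        = (fun ζ => I * bidiskKernel (cayley z.1, cayley z.2) ζ)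
          (cayleyCircle t.1, cayleyCircle t.2) := by
    intro z hz t
    have h1 := one_add_sq_ne_zero t.1
    have h2 := one_add_sq_ne_zero t.2
    rw [kernelK_eq hz]
    simp only [bidiskKernel, circleKernel_cayleyCircle hz.1, circleKernel_cayleyCircle hz.2]
    field_simp
  -- Here `cayleyInv 0` is `i`, and `b₁`, `b₂` are the masses of the circles over infinity.
  refine ⟨(q (cayleyInv 0, cayleyInv 0)).re, ν.real (Prod.fst ⁻¹' {circleOne}),
    ν.real (Prod.snd ⁻¹' {circleOne}), planeMeasure ν, measureReal_nonneg, measureReal_nonneg,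
    growthCondition_planeMeasure ν, fun z hz => ?_, fun z hz => ?_⟩
  · have hw₁ := norm_cayley_lt_one hz.1
    have hw₂ := norm_cayley_lt_one hz.2
    have hk₁ := continuous_circleKernel hw₁
    have hk₂ := continuous_circleKernel hw₂
    set k : UnitCircle × UnitCircle → ℂ := fun ζ =>
      conj (circleKernel (cayley z.1) ζ.1) * circleKernel (cayley z.2) ζ.2
    have hk : Continuous k := by fun_prop
    have h0 : ∫ ζ in {ζ | ζ.1 ≠ circleOne ∧ ζ.2 ≠ circleOne}, k ζ ∂ν = 0 :=
      setIntegral_conj_circleKernel_mul horth (w := (cayley z.1, cayley z.2)) hw₁ hw₂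
    -- The whole complex integral vanishes, but the Nevanlinna condition needs only its real part.
    have hre : ∫ ζ in {ζ | ζ.1 ≠ circleOne ∧ ζ.2 ≠ circleOne}, (k ζ).re ∂ν = 0 := by
      have h1 : ∫ ζ in {ζ | ζ.1 ≠ circleOne ∧ ζ.2 ≠ circleOne}, (k ζ).re ∂ν
          = (∫ ζ in {ζ | ζ.1 ≠ circleOne ∧ ζ.2 ≠ circleOne}, k ζ ∂ν).re :=
        integral_re (integrable_of_continuous hk)
      rw [h1, h0, zero_re]
    apply ofReal_injective
    rw [← integral_complex_ofReal, integral_planeMeasure ν (k := fun ζ => ((4 * (k ζ).re : ℝ) : ℂ)),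
      integral_complex_ofReal, integral_const_mul, hre]
    · simp
    · intro t
      have h1 := one_add_sq_ne_zero t.1
      have h2 := one_add_sq_ne_zero t.2
      rw [nevanlinnaKernel_eq hz]
      simp only [k, circleKernel_cayleyCircle hz.1, circleKernel_cayleyCircle hz.2]
      push_cast
      field_simp
  · have hw₁ := norm_cayley_lt_one hz.1
    have hw₂ := norm_cayley_lt_one hz.2
    have h1 := (h (cayley z.1, cayley z.2) hw₁ hw₂).1
    simp only [Function.comp, cayleyInv_cayley hz.1, cayleyInv_cayley hz.2] at h1
    rw [integral_eq_add_boundary horth (continuous_bidiskKernel hw₁ hw₂),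
      setIntegral_bidiskKernel_fst horth hw₂, setIntegral_bidiskKernel_snd horth hw₁] at h1
    have h2 := I_mul_one_add_two_mul_circleKernel hz.1
    have h3 := I_mul_one_add_two_mul_circleKernel hz.2
    have hpi : (Real.pi : ℂ) ≠ 0 := ofReal_ne_zero.2 Real.pi_ne_zero
    rw [integral_planeMeasure ν
      (k := fun ζ => I * bidiskKernel (cayley z.1, cayley z.2) ζ) (hbK z hz), integral_const_mul, h1]
    field_simp
    linear_combination (ν.real (Prod.fst ⁻¹' {circleOne}) : ℂ) * h2
      + (ν.real (Prod.snd ⁻¹' {circleOne}) : ℂ) * h3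

end HerglotzNevanlinna

theorem mainTheorem3 (q : ℂ × ℂ → ℂ) (hq : HerglotzNevanlinna.IsHerglotzNevanlinna q) :
    (∀ ζ ∈ HerglotzNevanlinna.polyUpperHalfPlane, (q ζ).im = 0 →
      ∀ z ∈ HerglotzNevanlinna.polyUpperHalfPlane, q z = q ζ) ∧
    (∃ (a b₁ b₂ : ℝ) (μ : Measure (ℝ × ℝ)),
      HerglotzNevanlinna.IsRepresentation q a b₁ b₂ μ) ∧
    (∀ (a b₁ b₂ : ℝ) (μ : Measure (ℝ × ℝ)),
      HerglotzNevanlinna.IsRepresentation q a b₁ b₂ μ →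
      (∀ z ∈ HerglotzNevanlinna.polyUpperHalfPlane,
        Integrable (HerglotzNevanlinna.polyPoissonKernel z) μ ∧
        (q z).im = b₁ * z.1.im + b₂ * z.2.im
          + 1 / Real.pi ^ 2 * ∫ t, HerglotzNevanlinna.polyPoissonKernel z t ∂μ) ∧
      a = (q (I, I)).re ∧
      (∀ α : ℂ, 0 < α.im →
        HerglotzNevanlinna.NontangentialLimitAtInfty (fun z => q (z, α) / z) (b₁ : ℂ)) ∧
      (∀ β : ℂ, 0 < β.im →
        HerglotzNevanlinna.NontangentialLimitAtInfty (fun z => q (β, z) / z) (b₂ : ℂ))) := by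
  exact ⟨fun ζ hζ h0 z hz => hq.eq_of_im_eq_zero hζ h0 hz, hq.exists_isRepresentation,
    fun a b₁ b₂ μ h => ⟨fun z hz =>
      ⟨HerglotzNevanlinna.integrable_polyPoissonKernel h.growth hz, h.im_eq hz⟩, h.eq_re,
      fun α hα => h.nontangentialLimit_fst hα, fun β hβ => h.nontangentialLimit_snd hβ⟩⟩
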